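/- **Setting.** Let $\mathcal X$ be a measurable space, $C,K,N$ integers with $K\ge 1$, $K+1\le C$, $N\ge 1$, and let $\mathcal D$ be a probability distribution on $\mathcal X\times\{0,1\}^C$. For $y\in\{0,1\}^C$ put $P(y)=\{i: y_i=1\}$, $N(y)=|P(y)|$, $N_K(y)=\min\{K,N(y)\}$, and assume $N(y)\le K$ for $\mathcal D$-almost every $(x,y)$. Let $$\alpha_1=1,\qquad \alpha_2=N_K(y),\qquad \alpha_3=\tfrac12 N_K(y)\,(2K+1-N_K(y)).$$ Let $\mathcal F$ be a class of measurable functions $f:\mathcal X\to\mathbb R^C$ that is pointwise separable: there is a countable $\mathcal G\subseteq\mathcal F$ such that each $f\in\mathcal F$ is the pointwise limit of a sequence in $\mathcal G$. Let $T=\{f(x)_i-f(x)_j : f\in\mathcal F,\ x\in\mathcal X,\ 1\le i,j\le C\}$, and let $\ell:\mathbb R\to\mathbb R$ be a surrogate loss that on $T$ is $\mu_\ell$-Lipschitz with $0\le \ell\le M_\ell$. For $\alpha\in\{\alpha_1,\alpha_2,\alpha_3\}$ and a score vector $s\in\mathbb R^C$ with non-increasing rearrangement $s_{[1]}\ge\dots\ge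 s_{[C]}$, the TKPR surrogate loss is $$L_K^{\alpha,\ell}(s,y)=\frac1{\alpha K}\sum_{i\in P(y)}\ \sum_{k=1}^{K+1}\ell\big(s_i-s_{[k]}\big)\qquad(\text{equal to }0\text{ if }P(y)=\emptyset),$$ and the surrogate risk is $\mathcal R_K^{\alpha,\ell}(f)=\mathbb E_{(x,y)\sim\mathcal D}\,L_K^{\alpha,\ell}(f(x),y)$. Let $M_K=(K+1)M_\ell$ for $\alpha\in\{\alpha_1,\alpha_2\}$ and $M_K=\frac{K+1}{K}M_\ell$ for $\alpha=\alpha_3$. For an i.i.d. sample $\mathcal S=((x^{(n)},y^{(n)}))_{n=1}^N$ from $\mathcal D$, put $$\Phi_f(\mathcal S,\delta)=\frac1N\sum_{n=1}^N L_K^{\alpha,\ell}(f(x^{(n)}),y^{(n)})+3M_K\sqrt{\frac{\log(2/\delta)}{2N}},\qquad \hat{\mathfrak C}_{\mathcal S}(\mathcal F)=\mathbb E_{\xi}\sup_{f\in\mathcal F}\frac1N\sum_{n=1}^N\sum_{c=1}^C\xi_{n,c}\,f(x^{(n)})_c,$$ where the $\xi_{n,c}$ are i.i.d. with a fixed symmetric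 law $\nu$ on $\mathbb R$ with $0<\mathbb E|\xi|<\infty$ (e.g. uniform on $\{-1,1\}$, giving the Rademacher complexity, or standard normal, giving the Gaussian complexity). **Proposition.** There is a constant $A>0$ depending only on $\nu$ (not on $\mathcal X,\mathcal D,\mathcal F,\ell,\mu_\ell,M_\ell,C,K,N,\alpha,\delta$) such that, in the setting above, $L_K^{\alpha,\ell}(f(x),y)$ is $\mathcal D$-integrable for each $f\in\mathcal F$ and, for every $\delta\in(0,1)$, with probability at least $1-\delta$ over $\mathcal S$, simultaneously for all $f\in\mathcal F$, $$\mathcal R_K^{\alpha,\ell}(f)\ \le\ \Phi_f(\mathcal S,\delta)+ \begin{cases}A\,\mu_\ell\,\sqrt K\;\hat{\mathfrak C}_{\mathcal S}(\mathcal F), & \alpha\in\{\alpha_1,\alpha_2\},\\[2pt] A\,\mu_\ell\,\dfrac1K\;\hat{\mathfrak C}_{\mathcal S}(\mathcal F), & \alpha=\alpha_3.\end{cases}$$ (The inequality is asserted for samples at which every set $\{f(x^{(n)}):f\in\mathcal F\}$ is bounded; otherwise $\hat{\mathfrak C}_{\mathcal S}(\mathcal F)=+\infty$ and there is nothing to assert.)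 -/

import Mathlib

open MeasureTheory Filter Topology
open scoped NNReal

noncomputable section

namespace TKPR

/-- Label vectors `y ∈ {0,1}^C`; `y i = true` means that label `i` is relevant. -/
abbrev Label (C : ℕ) : Type := Fin C → Bool

/-- Score vectors `s ∈ ℝ^C`, with the Euclidean norm. -/
abbrev Score (C : ℕ) : Type := EuclideanSpace ℝ (Fin C)

/-- The set `P(y)` of relevant labels. -/
def relevant {C : ℕ} (y : Label C) : Finset (Fin C) :=
  Finset.univ.filter fun i => y i = true

/-- The number `N(y)` of relevant labels. -/
def numRelevant {C : ℕ} (y : Label C) : ℕ := (relevant y).card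

/-- `N_K(y) = min {K, N(y)}`. -/
def numRelevantCut {C : ℕ} (K : ℕ) (y : Label C) : ℕ := min K (numRelevant y)

/-- The three weighting terms `α₁`, `α₂`, `α₃`. -/
inductive Weighting
  | one
  | two
  | three

/-- `α₁ = 1`, `α₂ = N_K(y)`, `α₃ = N_K(y) (2K + 1 - N_K(y)) / 2`. -/
def Weighting.weight {C : ℕ} (K : ℕ) (y : Label C) : Weighting → ℝ
  | .one => 1
  | .two => numRelevantCut K y
  | .three => (numRelevantCut K y : ℝ) * ((2 * (K : ℝ) + 1 - numRelevantCut K y) / 2)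

/-- The upper bound `M_K` of the surrogate loss when `ℓ` is bounded by `M`. -/
def Weighting.lossBound (K : ℕ) (M : ℝ) : Weighting → ℝ
  | .one => ((K : ℝ) + 1) * M
  | .two => ((K : ℝ) + 1) * M
  | .three => ((K : ℝ) + 1) / K * M

/-- The order in `K` of the factor in front of the complexity:
`√K` for `α₁` and `α₂`, and `1 / K` for `α₃`. -/
def Weighting.rate (K : ℕ) : Weighting → ℝ
  | .one => Real.sqrt K
  | .two => Real.sqrt K
  | .three => 1 / (K : ℝ)

/-- The entries of `s` in non-increasing order: `kthLargest s k` (with `k` counted from `0`)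
is the top-`(k+1)` entry `s_[k+1]`. -/
def kthLargest {C : ℕ} (s : Score C) (k : Fin C) : ℝ :=
  s (Tuple.sort (fun i => s i) k.rev)

/-- The TKPR surrogate loss
`(1 / (α K)) ∑_{y ∈ P(y)} ∑_{k ≤ K + 1} ℓ (s_y - s_[k])` of a score vector `s`;
the ranks `1, …, K + 1` are the indices `k` with `k ≤ K` counted from `0`.
When no label is relevant the double sum is empty and the loss is `0`. -/
def surrogateLoss {C : ℕ} (w : Weighting) (K : ℕ) (ℓ : ℝ → ℝ) (s : Score C) (y : Label C) : ℝ :=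
  1 / (w.weight K y * K) *
    ∑ i ∈ relevant y, ∑ k ∈ Finset.univ.filter (fun k : Fin C => (k : ℕ) ≤ K),
      ℓ (s i - kthLargest s k)

/-- The surrogate risk: the expected surrogate loss of `f` under the distribution `D`. -/
def risk {X : Type*} [MeasurableSpace X] {C : ℕ} (w : Weighting) (K : ℕ) (ℓ : ℝ → ℝ)
    (D : Measure (X × Label C)) (f : X → Score C) : ℝ :=
  ∫ z, surrogateLoss w K ℓ (f z.1) z.2 ∂D

/-- The empirical surrogate risk of `f` on the sample `S`. -/
def empRisk {X : Type*} {C N : ℕ} (w : Weighting) (K : ℕ) (ℓ : ℝ → ℝ)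
    (S : Fin N → X × Label C) (f : X → Score C) : ℝ :=
  1 / (N : ℝ) * ∑ n, surrogateLoss w K ℓ (f (S n).1) (S n).2

/-- `Φ(L, δ)`: the empirical risk plus the confidence term `3 M √(log (2/δ) / (2N))`,
where `M` is the upper bound of the loss. -/
def Phi {X : Type*} {C N : ℕ} (w : Weighting) (K : ℕ) (ℓ : ℝ → ℝ) (M δ : ℝ)
    (S : Fin N → X × Label C) (f : X → Score C) : ℝ :=
  empRisk w K ℓ S f +
    3 * w.lossBound K M * Real.sqrt (Real.log (2 / δ) / (2 * (N : ℝ)))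

/-- The empirical complexity of the class `F` of vector-valued score functions on the inputs `x`,
`E_ξ sup_{f ∈ F} (1/N) ∑_n ∑_c ξ_{n,c} f(x_n)_c`, with `ξ_{n,c}` i.i.d. of law `ν`. -/
def complexity {X : Type*} {C N : ℕ} (ν : Measure ℝ) (F : Set (X → Score C)) (x : Fin N → X) : ℝ :=
  ∫ ξ : Fin N × Fin C → ℝ,
    (⨆ f : F, 1 / (N : ℝ) * ∑ n, ∑ c, ξ (n, c) * (f : X → Score C) (x n) c)
    ∂(Measure.pi fun _ => ν)

/-- The differences `f(x)_i - f(x)_j` of scores given by functions in `F`: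
the set of all arguments to which the surrogate `ℓ` can be applied. -/
def scoreDiffs {X : Type*} {C : ℕ} (F : Set (X → Score C)) : Set ℝ :=
  {t | ∃ f ∈ F, ∃ x i j, t = f x i - f x j}

/-- A pointwise separable class of measurable functions: it has a countable subclass such that
every member of the class is the pointwise limit of a sequence from the subclass. -/
def PointwiseSeparable {X : Type*} [MeasurableSpace X] {C : ℕ} (F : Set (X → Score C)) : Prop :=
  (∀ f ∈ F, Measurable f) ∧
    ∃ G ⊆ F, G.Countable ∧ ∀ f ∈ F, ∃ u : ℕ → X → Score C,
      (∀ m, u m ∈ G) ∧ ∀ x, Tendsto (fun m => u m x) atTop (𝓝 (f x))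

end TKPR

end

/-! The bound combines a Rademacher generalization bound with a contraction inequality for
vector-valued classes.

For a countable class with values in `[0, B]`, let `G` be the largest gap between mean and empirical
mean and `R` the empirical Rademacher average. Changing one sample point moves either by at most `B
/ N`, so by McDiarmid `G < 𝔼 G + t` and `𝔼 R < R + t` outside probability `δ`. Symmetrization gives
`𝔼 G ≤ 2 𝔼 R`, hence `G ≤ 2 R + 3 t`, the source of the factor 3. Pointwise separability carries
this to the whole class.

To bound `R` by the complexity of the scores, each sign is traded for a vector of `C` signs. This
costs the `L¹` Khintchine constant and a Euclidean Lipschitz constant of the loss. Averaging over a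
symmetric law instead of signs costs `1 / 𝔼|ξ|` (`integral_abs_mul_expect_le`).

The Lipschitz constant is free of `C`: sorting is 1-Lipschitz in the Euclidean norm
(`sum_sq_kthLargest_sub_le`), and only `N(y) ≤ K` relevant entries and `K + 1` ranks occur, so
Cauchy–Schwarz gives at most `4 μ` times the rate. Extending `ℓ` beyond the score differences and
cutting the loss off where `N(y) > K` makes these bounds hold everywhere. -/

open scoped BigOperators

/-! ### Concentration under bounded differences -/

open ProbabilityTheory in
/-- **McDiarmid**: exponential moments of a function with bounded differences. -/
theorem integral_exp_le_of_bounded_differences {Z : Type*} [MeasurableSpace Z] (D : Measure Z)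
    [IsProbabilityMeasure D] (c : ℝ≥0) (t : ℝ) (n : ℕ) (f : (Fin n → Z) → ℝ) (hf : Measurable f)
    (B : ℝ) (hB : ∀ S, |f S| ≤ B)
    (hd : ∀ S k z, |f (Function.update S k z) - f S| ≤ c) :
    ∫ S, Real.exp (t * (f S - ∫ S', f S' ∂Measure.pi fun _ => D)) ∂(Measure.pi fun _ => D) ≤
      Real.exp (n * (c / 2) ^ 2 * t ^ 2 / 2) := by
  induction n with
  | zero =>
    obtain ⟨a, rfl⟩ : ∃ a, f = fun _ => a :=
      ⟨f default, funext fun S => by rw [Subsingleton.elim S default]⟩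
    simp
  | succ n ih =>
    set P : Measure (Fin n → Z) := Measure.pi fun _ => D with hP
    let g : (Fin n → Z) → ℝ := fun S => ∫ z, f (Fin.cons z S) ∂D
    have hcons : Measurable fun p : Z × (Fin n → Z) => (Fin.cons p.1 p.2 : Fin (n + 1) → Z) := by
      refine measurable_pi_iff.2 fun i => ?_
      refine Fin.cases ?_ (fun j => ?_) i
      · simpa using measurable_fst
      · simp only [Fin.cons_succ]; fun_prop
    have hfc : Measurable fun p : Z × (Fin n → Z) => f (Fin.cons p.1 p.2) := hf.comp hcons
    have hfz : ∀ S : Fin n → Z, Measurable fun z => f (Fin.cons z S) := fun S =>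
      hfc.comp (measurable_id.prodMk measurable_const)
    have hfi : ∀ S : Fin n → Z, Integrable (fun z => f (Fin.cons z S)) D := fun S =>
      Integrable.of_bound (hfz S).aestronglyMeasurable B (ae_of_all _ fun z => hB _)
    have hgm : Measurable g := by
      have := (hfc.comp measurable_swap).stronglyMeasurable.integral_prod_right' (ν := D)
      exact this.measurable
    have hgB : ∀ S, |g S| ≤ B := fun S => by
      have := norm_integral_le_of_norm_le_const (μ := D) (f := fun z => f (Fin.cons z S))
        (ae_of_all _ fun z => hB _)
      simpa using this
    have hgd : ∀ S k z, |g (Function.update S k z) - g S| ≤ c := fun S k z => by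
      have : g (Function.update S k z) - g S =
          ∫ w, (f (Fin.cons w (Function.update S k z)) - f (Fin.cons w S)) ∂D :=
        (integral_sub (hfi _) (hfi _)).symm
      rw [this]
      have := norm_integral_le_of_norm_le_const (μ := D) (C := c)
        (f := fun w => f (Fin.cons w (Function.update S k z)) - f (Fin.cons w S))
        (ae_of_all _ fun w => by
          rw [Fin.cons_update]; exact hd _ _ _)
      simpa using this
    have mp := (measurePreserving_piFinSuccAbove (fun _ : Fin (n + 1) => D) 0).symm
    -- Fubini with the zeroth coordinate split off; boundedness supplies integrability.
    have key : ∀ φ : (Fin (n + 1) → Z) → ℝ, Measurable φ → (∃ b, ∀ S, |φ S| ≤ b) →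
        ∫ S, φ S ∂(Measure.pi fun _ => D) = ∫ S, ∫ z, φ (Fin.cons z S) ∂D ∂P := by
      rintro φ hφ ⟨b, hb⟩
      rw [← mp.integral_comp' (g := φ)]
      have e : ∀ p : Z × (Fin n → Z),
          (MeasurableEquiv.piFinSuccAbove (fun _ : Fin (n + 1) => Z) 0).symm p =
            Fin.cons p.1 p.2 := fun p => by
        simp [MeasurableEquiv.piFinSuccAbove, Fin.insertNthEquiv]
      simp_rw [e]
      exact integral_prod_symm (fun p : Z × (Fin n → Z) => φ (Fin.cons p.1 p.2))
        (Integrable.of_bound (hφ.comp hcons).aestronglyMeasurable b (ae_of_all _ fun z => hb _))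
    have hm : ∫ S, f S ∂(Measure.pi fun _ => D) = ∫ S, g S ∂P := key f hf ⟨B, hB⟩
    set m := ∫ S, g S ∂P with hmdef
    have hexpb : ∀ x : ℝ, |x| ≤ B → |Real.exp (t * (x - m))| ≤ Real.exp (|t| * (B + |m|)) :=
      fun x hx => by
        rw [abs_of_pos (Real.exp_pos _)]
        refine Real.exp_le_exp.2 ((le_abs_self _).trans ?_)
        rw [abs_mul]
        gcongr
        exact (abs_sub _ _).trans (by linarith)
    rw [hm, key (fun S => Real.exp (t * (f S - m))) (by fun_prop)
      ⟨_, fun S => hexpb _ (hB S)⟩]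
    -- Hoeffding's lemma with the other coordinates frozen: as a function of `z`, `f` oscillates by
    -- at most `c`, hence lies in `[a, a + c]` with `a` its infimum and is sub-Gaussian with
    -- parameter `(c / 2) ^ 2` around its mean `g S`.
    have hin : ∀ S, ∫ z, Real.exp (t * (f (Fin.cons z S) - m)) ∂D ≤
        Real.exp ((c / 2) ^ 2 * t ^ 2 / 2) * Real.exp (t * (g S - m)) := fun S => by
      have hne : Nonempty Z := nonempty_of_isProbabilityMeasure D
      have hbd : BddBelow (Set.range fun z => f (Fin.cons z S)) :=
        ⟨-B, by rintro _ ⟨z, rfl⟩; exact (abs_le.1 (hB _)).1⟩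
      set a := ⨅ z, f (Fin.cons z S)
      have hI := hasSubgaussianMGF_of_mem_Icc (μ := D) (X := fun z => f (Fin.cons z S)) (a := a)
        (b := a + c) (hfz S).aemeasurable (ae_of_all _ fun z => ⟨ciInf_le hbd z, by
          have : f (Fin.cons z S) - c ≤ a := le_ciInf fun w => by
            have := hd (Fin.cons w S) 0 z
            rw [Fin.update_cons_zero] at this
            linarith [(abs_le.1 this).2]
          linarith⟩)
      have h1 := hI.mgf_le t
      have e1 : ∀ z, Real.exp (t * (f (Fin.cons z S) - m)) =
          Real.exp (t * (f (Fin.cons z S) - g S)) * Real.exp (t * (g S - m)) := fun z => by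
        rw [← Real.exp_add]; ring_nf
      simp_rw [e1]
      rw [integral_mul_const]
      gcongr
      refine h1.trans (le_of_eq ?_)
      simp
    calc ∫ S, ∫ z, Real.exp (t * (f (Fin.cons z S) - m)) ∂D ∂P
        ≤ ∫ S, Real.exp ((c / 2) ^ 2 * t ^ 2 / 2) * Real.exp (t * (g S - m)) ∂P := by
          refine integral_mono ?_ ?_ hin
          · have hmm : Measurable fun p : (Fin n → Z) × Z => Real.exp (t * (f (Fin.cons p.2 p.1) - m)) := by
              have := hfc.comp measurable_swap
              simp only [Function.comp_def, Prod.fst_swap, Prod.snd_swap] at this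
              fun_prop
            refine Integrable.of_bound
              (hmm.stronglyMeasurable.integral_prod_right' (ν := D)).aestronglyMeasurable
              (Real.exp (|t| * (B + |m|))) (ae_of_all _ fun S => ?_)
            have := norm_integral_le_of_norm_le_const (μ := D)
              (f := fun z => Real.exp (t * (f (Fin.cons z S) - m)))
              (ae_of_all _ fun z => hexpb _ (hB _))
            simpa using this
          · refine Integrable.const_mul ?_ _
            exact Integrable.of_bound (by fun_prop) _ (ae_of_all _ fun S => hexpb _ (hgB S))
      _ = Real.exp ((c / 2) ^ 2 * t ^ 2 / 2) * ∫ S, Real.exp (t * (g S - m)) ∂P :=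
          integral_const_mul _ _
      _ ≤ Real.exp ((c / 2) ^ 2 * t ^ 2 / 2) * Real.exp (n * (c / 2) ^ 2 * t ^ 2 / 2) := by
          gcongr
          exact ih g hgm hgB hgd
      _ = _ := by
          rw [← Real.exp_add]; push_cast; ring_nf

/-- **McDiarmid's inequality**. -/
theorem measure_ge_le_of_bounded_differences {Z : Type*} [MeasurableSpace Z] (D : Measure Z)
    [IsProbabilityMeasure D] (c : ℝ≥0) (n : ℕ) (f : (Fin n → Z) → ℝ) (hf : Measurable f)
    (B : ℝ) (hB : ∀ S, |f S| ≤ B)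
    (hd : ∀ S k z, |f (Function.update S k z) - f S| ≤ c) {ε : ℝ} (hε : 0 ≤ ε) :
    (Measure.pi fun _ : Fin n => D).real
        {S | ε ≤ f S - ∫ S', f S' ∂Measure.pi fun _ => D} ≤
      Real.exp (-ε ^ 2 / (2 * (n * (c / 2) ^ 2))) := by
  set m := ∫ S', f S' ∂Measure.pi fun _ : Fin n => D
  have h : ProbabilityTheory.HasSubgaussianMGF (fun S => f S - m) (n * (c / 2) ^ 2)
      (Measure.pi fun _ : Fin n => D) :=
    { integrable_exp_mul := fun t => by
        refine Integrable.of_bound (by fun_prop) (Real.exp (|t| * (B + |m|)))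
          (ae_of_all _ fun S => ?_)
        rw [Real.norm_eq_abs, abs_of_pos (Real.exp_pos _)]
        refine Real.exp_le_exp.2 ((le_abs_self _).trans ?_)
        rw [abs_mul]
        gcongr
        exact (abs_sub _ _).trans (by linarith [hB S])
      mgf_le := fun t => by
        have := integral_exp_le_of_bounded_differences D c t n f hf B hB hd
        simpa [ProbabilityTheory.mgf] using this }
  have := h.measure_ge_le hε
  simpa using this

/-! ### Suprema of bounded families and of weighted sample sums -/

theorem abs_ciSup_sub_ciSup_le {ι : Type*} [Nonempty ι] {a b : ι → ℝ} {c : ℝ}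
    (ha : BddAbove (Set.range a)) (hb : BddAbove (Set.range b)) (h : ∀ i, |a i - b i| ≤ c) :
    |(⨆ i, a i) - ⨆ i, b i| ≤ c := by
  have h1 : (⨆ i, a i) ≤ (⨆ i, b i) + c :=
    ciSup_le fun i => by linarith [le_ciSup hb i, (abs_le.1 (h i)).2]
  have h2 : (⨆ i, b i) ≤ (⨆ i, a i) + c :=
    ciSup_le fun i => by linarith [le_ciSup ha i, (abs_le.1 (h i)).1]
  exact abs_le.2 ⟨by linarith, by linarith⟩

theorem abs_ciSup_le {ι : Type*} [Nonempty ι] {a : ι → ℝ} {c : ℝ} (h : ∀ i, |a i| ≤ c) :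
    |⨆ i, a i| ≤ c := by
  have ha : BddAbove (Set.range a) := ⟨c, by rintro _ ⟨i, rfl⟩; exact (abs_le.1 (h i)).2⟩
  obtain ⟨i⟩ := ‹Nonempty ι›
  exact abs_le.2 ⟨(abs_le.1 (h i)).1.trans (le_ciSup ha i),
    have : Nonempty ι := ⟨i⟩
    ciSup_le fun i => (abs_le.1 (h i)).2⟩

theorem bddAbove_range_of_abs_le {ι : Type*} {a : ι → ℝ} {c : ℝ} (h : ∀ i, |a i| ≤ c) :
    BddAbove (Set.range a) := ⟨c, by rintro _ ⟨i, rfl⟩; exact (abs_le.1 (h i)).2⟩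

/-- The supremum over `i` of `a i` plus the weighted sum of the values of `h i` on the sample. -/
noncomputable def supSum {ι Z : Type*} {N : ℕ} (a : ι → ℝ) (x : Fin N → ℝ) (h : ι → Z → ℝ) (S : Fin N → Z) : ℝ :=
  ⨆ i, (a i + ∑ n, x n * h i (S n))

section supSum

variable {ι Z : Type*} {N : ℕ} {a : ι → ℝ} {x : Fin N → ℝ} {h : ι → Z → ℝ} {A B : ℝ}

theorem abs_supSum_summand_le (ha : ∀ i, |a i| ≤ A) (hh : ∀ i z, |h i z| ≤ B) (S : Fin N → Z)
    (i : ι) : |a i + ∑ n, x n * h i (S n)| ≤ A + ∑ n, |x n| * B := by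
  refine (abs_add_le _ _).trans (add_le_add (ha i) ((Finset.abs_sum_le_sum_abs _ _).trans ?_))
  refine Finset.sum_le_sum fun n _ => ?_
  rw [abs_mul]
  exact mul_le_mul_of_nonneg_left (hh _ _) (abs_nonneg _)

theorem measurable_supSum [Countable ι] [MeasurableSpace Z] (hm : ∀ i, Measurable (h i)) :
    Measurable (supSum a x h) :=
  Measurable.iSup fun i => by
    have := hm i
    fun_prop

theorem le_supSum (ha : ∀ i, |a i| ≤ A) (hh : ∀ i z, |h i z| ≤ B) (S : Fin N → Z) (i : ι) :
    a i + ∑ n, x n * h i (S n) ≤ supSum a x h S :=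
  le_ciSup (f := fun i => a i + ∑ n, x n * h i (S n))
    (bddAbove_range_of_abs_le fun i => abs_supSum_summand_le ha hh S i) i

variable [Nonempty ι]

theorem abs_supSum_le (ha : ∀ i, |a i| ≤ A) (hh : ∀ i z, |h i z| ≤ B) (S : Fin N → Z) :
    |supSum a x h S| ≤ A + ∑ n, |x n| * B :=
  abs_ciSup_le fun i => abs_supSum_summand_le ha hh S i

/-- Only the `k`-th summand changes, uniformly in `i`. The oscillation bound `hd` is a separate
hypothesis because `|h| ≤ B` alone would give `2 * B`; functions with values in `[0, B]` oscillate
by at most `B`. -/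
theorem abs_supSum_update_sub_le (ha : ∀ i, |a i| ≤ A) (hh : ∀ i z, |h i z| ≤ B)
    (hd : ∀ i z w, |h i z - h i w| ≤ B)
    {c : ℝ} (hx : ∀ n, |x n| ≤ c) (S : Fin N → Z) (k : Fin N) (z : Z) :
    |supSum a x h (Function.update S k z) - supSum a x h S| ≤ c * B := by
  refine abs_ciSup_sub_ciSup_le
    (bddAbove_range_of_abs_le fun i => abs_supSum_summand_le ha hh _ i)
    (bddAbove_range_of_abs_le fun i => abs_supSum_summand_le ha hh _ i) fun i => ?_
  have : a i + ∑ n, x n * h i (Function.update S k z n) - (a i + ∑ n, x n * h i (S n)) =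
      x k * (h i z - h i (S k)) := by
    rw [add_sub_add_left_eq_sub, ← Finset.sum_sub_distrib, Finset.sum_eq_single k]
    · simp; ring
    · intro n _ hn
      simp [Function.update_of_ne hn]
    · simp
  rw [this, abs_mul]
  exact mul_le_mul (hx k) (hd _ _ _) (abs_nonneg _) ((abs_nonneg _).trans (hx k))

end supSum

/-! ### Rademacher averages, symmetrization and the generalization bound -/

/-- The (unnormalized) Rademacher average of a family of vectors. -/
noncomputable def radAvg {ι : Type*} {N : ℕ} (v : ι → Fin N → ℝ) : ℝ :=
  𝔼 ε : Fin N → ℤˣ, ⨆ i, ∑ n, ((ε n : ℤ) : ℝ) * v i n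

theorem radAvg_eq_expect_supSum {ι Z : Type*} {N : ℕ} (h : ι → Z → ℝ) (S : Fin N → Z) :
    1 / (N : ℝ) * radAvg (fun i n => h i (S n)) =
      𝔼 ε : Fin N → ℤˣ, supSum 0 (fun n => 1 / (N : ℝ) * ((ε n : ℤ) : ℝ)) h S := by
  rw [radAvg, Finset.mul_expect]
  refine Finset.expect_congr rfl fun ε _ => ?_
  rw [Real.mul_iSup_of_nonneg (by positivity)]
  simp only [supSum, Pi.zero_apply, zero_add, Finset.mul_sum, mul_assoc]

theorem abs_sign (u : ℤˣ) : |((u : ℤ) : ℝ)| = 1 := by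
  rcases Int.units_eq_one_or u with rfl | rfl <;> simp

section symmetrization

variable {Z : Type*} [MeasurableSpace Z] (D : Measure Z) [IsProbabilityMeasure D]

/-- Exchanging some of the coordinates of two independent samples preserves their joint law. -/
theorem measurePreserving_swapCoords {N : ℕ} (ε : Fin N → ℤˣ) :
    MeasurePreserving
      (fun p : (Fin N → Z) × (Fin N → Z) =>
        ((fun n => if ε n = 1 then p.1 n else p.2 n, fun n => if ε n = 1 then p.2 n else p.1 n) :
          (Fin N → Z) × (Fin N → Z)))
      ((Measure.pi fun _ => D).prod (Measure.pi fun _ => D))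
      ((Measure.pi fun _ => D).prod (Measure.pi fun _ => D)) := by
  have m1 := measurePreserving_arrowProdEquivProdArrow Z Z (Fin N) (fun _ => D) (fun _ => D)
  have m2 : MeasurePreserving
      (fun (q : Fin N → Z × Z) n => (if ε n = 1 then id else Prod.swap : Z × Z → Z × Z) (q n))
      (Measure.pi fun _ => D.prod D) (Measure.pi fun _ => D.prod D) := by
    refine measurePreserving_pi _ _ fun n => ?_
    split_ifs
    · exact MeasurePreserving.id _
    · exact Measure.measurePreserving_swap
  have m3 := (m1.comp m2).comp m1.symm
  convert m3 using 1
  funext p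
  refine Prod.ext (funext fun n => ?_) (funext fun n => ?_)
  all_goals
    by_cases h : ε n = 1 <;>
      simp [h, MeasurableEquiv.arrowProdEquivProdArrow, Equiv.arrowProdEquivProdArrow]

/-- Symmetrization: the means are averages over an independent ghost sample, and pulling that
average out of the supremum leaves a supremum of differences. Exchanging coordinates between the two
samples preserves their law and inserts arbitrary signs; the signed supremum then splits into one
Rademacher supremum per sample, with signs `ε` and `-ε`. -/
theorem integral_supSum_le {ι : Type*} [Countable ι] [Nonempty ι] {N : ℕ} (hN : 1 ≤ N)
    {h : ι → Z → ℝ} {B : ℝ} (hm : ∀ i, Measurable (h i)) (hh : ∀ i z, |h i z| ≤ B) :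
    ∫ S, supSum (fun i => ∫ z, h i z ∂D) (fun _ : Fin N => -(1 / (N : ℝ))) h S
        ∂(Measure.pi fun _ => D) ≤
      2 * ∫ S, 1 / (N : ℝ) * radAvg (fun i n => h i (S n)) ∂(Measure.pi fun _ : Fin N => D) := by
  set P : Measure (Fin N → Z) := Measure.pi fun _ => D with hP
  have hN0 : (N : ℝ) ≠ 0 := by positivity
  let V : (Fin N → ℝ) → (Fin N → Z) → ℝ := fun x => supSum 0 x h
  have h0 : ∀ i : ι, |(0 : ι → ℝ) i| ≤ 0 := by simp
  have hVi : ∀ x, Integrable (V x) P := fun x =>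
    Integrable.of_bound (measurable_supSum hm).aestronglyMeasurable _
      (ae_of_all _ fun S => abs_supSum_le h0 hh S)
  have hhi : ∀ i, Integrable (h i) D := fun i =>
    Integrable.of_bound (hm i).aestronglyMeasurable B (ae_of_all _ fun z => hh i z)
  let W : (Fin N → ℝ) → (Fin N → Z) × (Fin N → Z) → ℝ := fun x p =>
    ⨆ i, ∑ n, x n * (h i (p.2 n) - h i (p.1 n))
  have hWb : ∀ (x : Fin N → ℝ) (p : (Fin N → Z) × (Fin N → Z)) i,
      |∑ n, x n * (h i (p.2 n) - h i (p.1 n))| ≤ ∑ n, |x n| * (B + B) :=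
    fun x p i => by
      refine (Finset.abs_sum_le_sum_abs _ _).trans (Finset.sum_le_sum fun n _ => ?_)
      rw [abs_mul]
      exact mul_le_mul_of_nonneg_left ((abs_sub _ _).trans (add_le_add (hh _ _) (hh _ _)))
        (abs_nonneg _)
  have hWm : ∀ x, Measurable (W x) := fun x => Measurable.iSup fun i => by
    have := hm i
    fun_prop
  have hWi : ∀ x, Integrable (W x) (P.prod P) := fun x =>
    Integrable.of_bound (hWm x).aestronglyMeasurable _
      (ae_of_all _ fun p => abs_ciSup_le fun i => hWb x p i)
  have hWS : ∀ x S, Integrable (fun S' => W x (S, S')) P := fun x S =>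
    Integrable.of_bound ((hWm x).comp (by fun_prop)).aestronglyMeasurable _
      (ae_of_all _ fun p => abs_ciSup_le fun i => hWb x _ i)
  have ghost_le : ∫ S, supSum (fun i => ∫ z, h i z ∂D) (fun _ : Fin N => -(1 / (N : ℝ))) h S ∂P ≤
      ∫ p, W (fun _ => 1 / (N : ℝ)) p ∂(P.prod P) := by
    rw [integral_prod _ (hWi _)]
    refine integral_mono ?_ ((hWi _).integral_prod_left) fun S => ?_
    · refine Integrable.of_bound (measurable_supSum hm).aestronglyMeasurable _
        (ae_of_all _ fun S => abs_supSum_le (A := B) (B := B) (fun i => ?_) hh S)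
      have := norm_integral_le_of_norm_le_const (μ := D) (f := h i) (ae_of_all _ fun z => hh i z)
      simpa using this
    · refine ciSup_le fun i => ?_
      have hev : ∀ n, ∫ S' : Fin N → Z, h i (S' n) ∂P = ∫ z, h i z ∂D := fun n => by
        have mp := measurePreserving_eval (fun _ : Fin N => D) n
        have := integral_map (μ := P) mp.measurable.aemeasurable (f := h i)
          (hm i).aestronglyMeasurable
        rw [mp.map_eq] at this
        exact this.symm
      have hevi : ∀ n, Integrable (fun S' : Fin N → Z => h i (S' n)) P := fun n =>
        (measurePreserving_eval (fun _ : Fin N => D) n).integrable_comp_of_integrable (hhi i)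
      have e : (∫ z, h i z ∂D) + ∑ n, -(1 / (N : ℝ)) * h i (S n) =
          ∫ S', ∑ n, 1 / (N : ℝ) * (h i (S' n) - h i (S n)) ∂P := by
        rw [integral_finsetSum]
        · have : ∀ n, ∫ S' : Fin N → Z, 1 / (N : ℝ) * (h i (S' n) - h i (S n)) ∂P =
              1 / (N : ℝ) * ((∫ z, h i z ∂D) - h i (S n)) := fun n => by
            rw [integral_const_mul, integral_sub (hevi n) (integrable_const _), hev]
            simp
          simp_rw [this, mul_sub, Finset.sum_sub_distrib]
          simp [hN0]
          ring
        · intro n _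
          exact ((hevi n).sub (integrable_const _)).const_mul _
      rw [e]
      refine integral_mono ?_ (hWS _ S) fun S' =>
        le_ciSup (f := fun i => ∑ n, 1 / (N : ℝ) * (h i (S' n) - h i (S n)))
          (bddAbove_range_of_abs_le fun i => hWb _ (S, S') i) i
      exact integrable_finsetSum _ fun n _ => ((hevi n).sub (integrable_const _)).const_mul _
  have swap_eq : ∀ ε : Fin N → ℤˣ, ∫ p, W (fun _ => 1 / (N : ℝ)) p ∂(P.prod P) =
      ∫ p, W (fun n => 1 / (N : ℝ) * ((ε n : ℤ) : ℝ)) p ∂(P.prod P) := fun ε => by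
    have mp := measurePreserving_swapCoords D ε
    have e1 := integral_map (μ := P.prod P) mp.measurable.aemeasurable
      (f := W (fun _ => 1 / (N : ℝ))) (hWm _).aestronglyMeasurable
    rw [mp.map_eq] at e1
    rw [e1]
    congr 1
    funext p
    refine iSup_congr fun i => Finset.sum_congr rfl fun n _ => ?_
    rcases Int.units_eq_one_or (ε n) with hε | hε
    · simp [hε]
    · have : (-1 : ℤˣ) ≠ 1 := by decide
      simp only [hε, this, if_false]
      push_cast
      ring
  have split_le : ∀ ε : Fin N → ℤˣ, ∫ p, W (fun n => 1 / (N : ℝ) * ((ε n : ℤ) : ℝ)) p ∂(P.prod P) ≤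
      ∫ S, V (fun n => 1 / (N : ℝ) * ((ε n : ℤ) : ℝ)) S ∂P +
        ∫ S, V (fun n => 1 / (N : ℝ) * (((-ε) n : ℤ) : ℝ)) S ∂P := fun ε => by
    have i1 : ∀ x, ∫ p : (Fin N → Z) × (Fin N → Z), V x p.2 ∂(P.prod P) = ∫ S, V x S ∂P :=
      fun x => by
        rw [integral_fun_snd]; simp
    have i2 : ∀ x, ∫ p : (Fin N → Z) × (Fin N → Z), V x p.1 ∂(P.prod P) = ∫ S, V x S ∂P :=
      fun x => by
        rw [integral_fun_fst]; simp
    rw [← i1, ← i2, ← integral_add ((hVi _).comp_snd P) ((hVi _).comp_fst P)]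
    refine integral_mono (hWi _) (((hVi _).comp_snd P).add ((hVi _).comp_fst P)) fun p => ?_
    refine ciSup_le fun i => ?_
    refine le_trans (le_of_eq ?_) (add_le_add (le_supSum h0 hh p.2 i) (le_supSum h0 hh p.1 i))
    simp only [Pi.zero_apply, zero_add, ← Finset.sum_add_distrib]
    refine Finset.sum_congr rfl fun n _ => ?_
    simp only [Pi.neg_apply, Units.val_neg]
    push_cast
    ring
  have integral_radAvg_eq : ∫ S, 1 / (N : ℝ) * radAvg (fun i n => h i (S n)) ∂P =
      𝔼 ε : Fin N → ℤˣ, ∫ S, V (fun n => 1 / (N : ℝ) * ((ε n : ℤ) : ℝ)) S ∂P := by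
    simp_rw [radAvg_eq_expect_supSum, Fintype.expect_eq_sum_div_card]
    rw [integral_div, integral_finsetSum _ fun ε _ => hVi _]
  calc _ ≤ _ := ghost_le
    _ = 𝔼 ε : Fin N → ℤˣ, ∫ p, W (fun _ => 1 / (N : ℝ)) p ∂(P.prod P) :=
        (Fintype.expect_const _).symm
    _ ≤ 𝔼 ε : Fin N → ℤˣ, (∫ S, V (fun n => 1 / (N : ℝ) * ((ε n : ℤ) : ℝ)) S ∂P +
          ∫ S, V (fun n => 1 / (N : ℝ) * (((-ε) n : ℤ) : ℝ)) S ∂P) :=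
        Finset.expect_le_expect fun ε _ => (swap_eq ε).trans_le (split_le ε)
    _ = _ := by
        rw [Finset.expect_add_distrib, integral_radAvg_eq, two_mul]
        congr 1
        exact Fintype.expect_equiv (Equiv.neg _) _ _ fun ε => rfl

/-- **Rademacher generalization bound** for a countable class of functions with values
in `[0, B]`. -/
theorem exists_measurableSet_generalization {ι : Type*} [Countable ι] [Nonempty ι] {N : ℕ}
    (hN : 1 ≤ N) {h : ι → Z → ℝ} {B : ℝ} (hB : 0 ≤ B) (hm : ∀ i, Measurable (h i))
    (hh : ∀ i z, 0 ≤ h i z ∧ h i z ≤ B) {δ : ℝ} (hδ : 0 < δ) (hδ1 : δ < 1) :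
    ∃ E : Set (Fin N → Z), MeasurableSet E ∧
      ENNReal.ofReal (1 - δ) ≤ (Measure.pi fun _ : Fin N => D) E ∧
      ∀ S ∈ E, ∀ i, ∫ z, h i z ∂D ≤ 1 / (N : ℝ) * ∑ n, h i (S n) +
        3 * B * Real.sqrt (Real.log (2 / δ) / (2 * N)) +
        2 * (1 / (N : ℝ) * radAvg fun i n => h i (S n)) := by
  -- The tail exponent below divides by `B ^ 2`, so `B = 0` is treated apart.
  rcases hB.eq_or_lt with rfl | hB
  · refine ⟨Set.univ, MeasurableSet.univ, ?_, fun S _ i => ?_⟩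
    · rw [measure_univ, ENNReal.ofReal_le_one]
      linarith
    · have h0 : ∀ i z, h i z = 0 := fun i z => le_antisymm (hh i z).2 (hh i z).1
      simp [radAvg, h0]
  set P : Measure (Fin N → Z) := Measure.pi fun _ => D with hP
  have hN0 : (0 : ℝ) < N := by positivity
  have hab : ∀ i z, |h i z| ≤ B := fun i z => abs_le.2 ⟨by linarith [(hh i z).1], (hh i z).2⟩
  have hdi : ∀ i z w, |h i z - h i w| ≤ B := fun i z w =>
    abs_le.2 ⟨by linarith [hh i z, hh i w], by linarith [(hh i z).2, (hh i w).1]⟩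
  have hIb : ∀ i, |∫ z, h i z ∂D| ≤ B := fun i => by
    have := norm_integral_le_of_norm_le_const (μ := D) (f := h i) (ae_of_all _ fun z => hab i z)
    simpa using this
  set a : ι → ℝ := fun i => ∫ z, h i z ∂D
  set G : (Fin N → Z) → ℝ := supSum a (fun _ => -(1 / (N : ℝ))) h with hG
  set R : (Fin N → Z) → ℝ := fun S => 1 / (N : ℝ) * radAvg fun i n => h i (S n) with hR
  have hRV : ∀ S, R S = 𝔼 ε : Fin N → ℤˣ,
      supSum 0 (fun n => 1 / (N : ℝ) * ((ε n : ℤ) : ℝ)) h S := radAvg_eq_expect_supSum h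
  have h0 : ∀ i : ι, |(0 : ι → ℝ) i| ≤ 0 := by simp
  have hRm : Measurable R := by
    have : R = fun S => 𝔼 ε : Fin N → ℤˣ,
      supSum 0 (fun n => 1 / (N : ℝ) * ((ε n : ℤ) : ℝ)) h S := funext hRV
    rw [this]
    simp_rw [Fintype.expect_eq_sum_div_card]
    exact (Finset.measurable_sum _ fun ε _ => measurable_supSum hm).div_const _
  have hxb : ∀ (ε : Fin N → ℤˣ) n, |1 / (N : ℝ) * ((ε n : ℤ) : ℝ)| ≤ 1 / (N : ℝ) := fun ε n => by
    rw [abs_mul, abs_sign, mul_one, abs_of_pos (by positivity)]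
  have hRb : ∀ S, |R S| ≤ 0 + ∑ n : Fin N, 1 / (N : ℝ) * B := fun S => by
    rw [hRV]
    refine (Finset.abs_expect_le _ _).trans ?_
    refine Finset.expect_le Finset.univ_nonempty fun ε _ => (abs_supSum_le h0 hab S).trans ?_
    gcongr with n
    exact hxb ε n
  have hRd : ∀ S k z, |R (Function.update S k z) - R S| ≤ 1 / (N : ℝ) * B := fun S k z => by
    rw [hRV, hRV, ← Finset.expect_sub_distrib]
    refine (Finset.abs_expect_le _ _).trans ?_
    exact Finset.expect_le Finset.univ_nonempty fun ε _ =>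
      abs_supSum_update_sub_le h0 hab hdi (hxb ε) S k z
  have hGm : Measurable G := measurable_supSum hm
  set c : ℝ≥0 := ⟨1 / (N : ℝ) * B, by positivity⟩ with hc
  have hcv : (c : ℝ) = 1 / (N : ℝ) * B := rfl
  -- With differences `B / N`, this deviation makes each of the two tails exactly `δ / 2`.
  set t : ℝ := B * Real.sqrt (Real.log (2 / δ) / (2 * N)) with ht
  have ht0 : 0 ≤ t := by positivity
  have hlog : 0 ≤ Real.log (2 / δ) := Real.log_nonneg (by rw [le_div_iff₀ hδ]; linarith)
  have hexp : Real.exp (-t ^ 2 / (2 * (N * ((c : ℝ) / 2) ^ 2))) = δ / 2 := by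
    have : -t ^ 2 / (2 * (N * ((c : ℝ) / 2) ^ 2)) = - Real.log (2 / δ) := by
      rw [ht, hcv, mul_pow, Real.sq_sqrt (by positivity)]
      field_simp
    rw [this, Real.exp_neg, Real.exp_log (by positivity), inv_div]
  have T1 := measure_ge_le_of_bounded_differences D c N G hGm _
    (fun S => abs_supSum_le hIb hab S)
    (fun S k z => abs_supSum_update_sub_le (c := 1 / (N : ℝ)) hIb hab hdi
      (fun n => by rw [abs_neg, abs_of_pos (by positivity)]) S k z) ht0
  have T2 := measure_ge_le_of_bounded_differences D c N (fun S => -R S) hRm.neg _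
    (fun S => by rw [abs_neg]; exact hRb S)
    (fun S k z => by
      rw [neg_sub_neg, abs_sub_comm]; exact hRd S k z) ht0
  rw [hexp, ← hP] at T1 T2
  set E1 := {S | t ≤ G S - ∫ S', G S' ∂P} with hE1
  set E2 := {S | t ≤ -R S - ∫ S', -R S' ∂P} with hE2
  have mE1 : MeasurableSet E1 := measurableSet_le measurable_const (hGm.sub measurable_const)
  have mE2 : MeasurableSet E2 := measurableSet_le measurable_const (hRm.neg.sub measurable_const)
  refine ⟨(E1 ∪ E2)ᶜ, (mE1.union mE2).compl, ?_, ?_⟩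
  · have h1 : P.real (E1 ∪ E2) ≤ δ := (measureReal_union_le _ _).trans (by linarith)
    have h2 := probReal_compl_eq_one_sub (μ := P) (mE1.union mE2)
    refine ENNReal.ofReal_le_of_le_toReal ?_
    change 1 - δ ≤ P.real (E1 ∪ E2)ᶜ
    linarith
  · intro S hS i
    simp only [Set.mem_compl_iff, Set.mem_union, not_or, hE1, hE2, Set.mem_ofPred_eq, not_le] at hS
    obtain ⟨s1, s2⟩ := hS
    rw [integral_neg] at s2
    have s3 : ∫ S, G S ∂P ≤ 2 * ∫ S, R S ∂P := integral_supSum_le D hN hm hab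
    have s4 := le_supSum (x := fun _ : Fin N => -(1 / (N : ℝ))) hIb hab S i
    change a i + _ ≤ G S at s4
    have s5 : ∑ n, -(1 / (N : ℝ)) * h i (S n) = - (1 / (N : ℝ) * ∑ n, h i (S n)) := by
      rw [← Finset.mul_sum, neg_mul]
    rw [s5] at s4
    change a i ≤ _ + _ + 2 * R S
    have : 3 * B * Real.sqrt (Real.log (2 / δ) / (2 * N)) = 3 * t := by rw [ht]; ring
    linarith

end symmetrization

/-! ### Moments of random signs and Khintchine's inequality -/

section signs

theorem expect_sign (f : ℤˣ → ℝ) : 𝔼 u, f u = (f 1 + f (-1)) / 2 := by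
  rw [Fintype.expect_eq_sum_div_card, show (Finset.univ : Finset ℤˣ) = {1, -1} from rfl,
    Finset.sum_pair (by decide)]
  simp

theorem expect_fin_succ {α : Type*} [Fintype α] {n : ℕ} (φ : (Fin (n + 1) → α) → ℝ) :
    𝔼 ε, φ ε = 𝔼 u, 𝔼 ε, φ (Fin.cons u ε) := by
  rw [← Finset.expect_product', Finset.univ_product_univ]
  exact (Fintype.expect_equiv (Fin.consEquiv fun _ => α) _ _ fun p => rfl).symm

theorem expect_sign_sum_sq {n : ℕ} (v : Fin n → ℝ) :
    𝔼 ε : Fin n → ℤˣ, (∑ k, ((ε k : ℤ) : ℝ) * v k) ^ 2 = ∑ k, v k ^ 2 := by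
  induction n with
  | zero => simp
  | succ n ih =>
    have e : ∀ (u : ℤˣ) (ε : Fin n → ℤˣ),
        ∑ k, (((Fin.cons u ε : Fin (n + 1) → ℤˣ) k : ℤ) : ℝ) * v k =
          ((u : ℤ) : ℝ) * v 0 + ∑ k, ((ε k : ℤ) : ℝ) * v k.succ := fun u ε => by
      simp [Fin.sum_univ_succ]
    rw [expect_fin_succ, Finset.expect_comm, Fin.sum_univ_succ, ← ih fun k => v k.succ]
    simp_rw [e, expect_sign]
    rw [← Fintype.expect_const (ι := Fin n → ℤˣ) (v 0 ^ 2), ← Finset.expect_add_distrib]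
    refine Finset.expect_congr rfl fun ε _ => ?_
    push_cast
    ring

/-- Averaging over one sign kills the odd powers in the binomial expansion, leaving `v₀⁴ + 6 v₀² T²
+ T⁴` with `T` the remaining sum, which closes the induction. -/
theorem expect_sign_sum_pow_four_le {n : ℕ} (v : Fin n → ℝ) :
    𝔼 ε : Fin n → ℤˣ, (∑ k, ((ε k : ℤ) : ℝ) * v k) ^ 4 ≤ 3 * (∑ k, v k ^ 2) ^ 2 := by
  induction n with
  | zero => simp
  | succ n ih =>
    have e : ∀ (u : ℤˣ) (ε : Fin n → ℤˣ),
        ∑ k, (((Fin.cons u ε : Fin (n + 1) → ℤˣ) k : ℤ) : ℝ) * v k =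
          ((u : ℤ) : ℝ) * v 0 + ∑ k, ((ε k : ℤ) : ℝ) * v k.succ := fun u ε => by
      simp [Fin.sum_univ_succ]
    have h2 := expect_sign_sum_sq fun k => v k.succ
    have h4 := ih fun k => v k.succ
    rw [expect_fin_succ, Finset.expect_comm, Fin.sum_univ_succ]
    simp_rw [e, expect_sign]
    set s := ∑ k : Fin n, v k.succ ^ 2
    calc _ = 𝔼 ε : Fin n → ℤˣ, (v 0 ^ 4 + 6 * v 0 ^ 2 * (∑ k, ((ε k : ℤ) : ℝ) * v k.succ) ^ 2 +
          (∑ k, ((ε k : ℤ) : ℝ) * v k.succ) ^ 4) := by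
          refine Finset.expect_congr rfl fun ε _ => ?_
          push_cast
          ring
      _ = v 0 ^ 4 + 6 * v 0 ^ 2 * s + 𝔼 ε : Fin n → ℤˣ, (∑ k, ((ε k : ℤ) : ℝ) * v k.succ) ^ 4 := by
          rw [Finset.expect_add_distrib, Finset.expect_add_distrib, Fintype.expect_const,
            ← Finset.mul_expect, h2]
      _ ≤ 3 * (v 0 ^ 2 + s) ^ 2 := by nlinarith [sq_nonneg (v 0 ^ 2)]

/-- **Khintchine's inequality** in `L¹`, with the constant `16 / 9`. -/
theorem sqrt_sum_sq_le_expect {n : ℕ} (v : Fin n → ℝ) :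
    Real.sqrt (∑ k, v k ^ 2) ≤
      16 / 9 * 𝔼 ε : Fin n → ℤˣ, |∑ k, ((ε k : ℤ) : ℝ) * v k| := by
  set r := Real.sqrt (∑ k, v k ^ 2) with hr
  have hs : 0 ≤ ∑ k, v k ^ 2 := Finset.sum_nonneg fun k _ => sq_nonneg _
  have hr2 : r ^ 2 = ∑ k, v k ^ 2 := Real.sq_sqrt hs
  have hE : 0 ≤ 𝔼 ε : Fin n → ℤˣ, |∑ k, ((ε k : ℤ) : ℝ) * v k| :=
    Finset.expect_nonneg fun ε _ => abs_nonneg _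
  rcases (Real.sqrt_nonneg _ : 0 ≤ r).eq_or_lt with h0 | h0
  · rw [hr, ← h0]; positivity
  -- A polynomial minorant of `|x|`, touching at `|x| = 2 r`, replaces Hölder's inequality. In
  -- expectation, with fourth moment at most `3 r ^ 4`, the left side is at least `(3/4 - 3/16) r ^
  -- 4 = 9/16 r ^ 4`.
  have hpt : ∀ x : ℝ, 3 / 4 * r ^ 2 * x ^ 2 - 1 / 16 * x ^ 4 ≤ r ^ 3 * |x| := fun x => by
    have hx := abs_nonneg x
    rw [← sq_abs x, show x ^ 4 = |x| ^ 4 by rw [← abs_pow, abs_of_nonneg (by positivity)]]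
    have : r ^ 3 * |x| - (3 / 4 * r ^ 2 * |x| ^ 2 - 1 / 16 * |x| ^ 4) =
        |x| * ((|x| - 2 * r) ^ 2 * (|x| + 4 * r)) / 16 := by ring
    have : 0 ≤ |x| * ((|x| - 2 * r) ^ 2 * (|x| + 4 * r)) / 16 := by positivity
    linarith
  have h := Finset.expect_le_expect (s := Finset.univ) fun (ε : Fin n → ℤˣ) _ =>
    hpt (∑ k, ((ε k : ℤ) : ℝ) * v k)
  rw [Finset.expect_sub_distrib, ← Finset.mul_expect, ← Finset.mul_expect, ← Finset.mul_expect,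
    expect_sign_sum_sq, ← hr2] at h
  have h4 := expect_sign_sum_pow_four_le v
  rw [← hr2] at h4
  have h5 : r ^ 3 * (9 / 16 * r) ≤
      r ^ 3 * 𝔼 ε : Fin n → ℤˣ, |∑ k, ((ε k : ℤ) : ℝ) * v k| := by
    linarith
  linarith [le_of_mul_le_mul_left h5 (by positivity)]

end signs

/-! ### Vector contraction -/

theorem ciSup_add_ciSup_le_of_forall {ι : Type*} [Nonempty ι] {a b : ι → ℝ} {x : ℝ}
    (h : ∀ i j, a i + b j ≤ x) : (⨆ i, a i) + ⨆ j, b j ≤ x := by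
  have : (⨆ i, a i) ≤ x - ⨆ j, b j := ciSup_le fun i => by
    have : (⨆ j, b j) ≤ x - a i := ciSup_le fun j => by linarith [h i j]
    linarith
  linarith

section contraction

variable {ι : Type*} [Nonempty ι]

/-- Replacing one sign by a vector of signs. -/
theorem half_ciSup_add_ciSup_le {C : ℕ} {g p : ι → ℝ} {q : ι → Fin C → ℝ} {A B : ℝ}
    (hg : ∀ i, |g i| ≤ A) (hq : ∀ i c, |q i c| ≤ B)
    (hpq : ∀ i j, |p i - p j| ≤ Real.sqrt (∑ c, (q i c - q j c) ^ 2)) :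
    ((⨆ i, (g i + p i)) + ⨆ i, (g i - p i)) / 2 ≤
      𝔼 δ : Fin C → ℤˣ, ⨆ i, (g i + 16 / 9 * ∑ c, ((δ c : ℤ) : ℝ) * q i c) := by
  set U : (Fin C → ℤˣ) → ℝ := fun δ => ⨆ i, (g i + 16 / 9 * ∑ c, ((δ c : ℤ) : ℝ) * q i c)
  have hU : ∀ δ i, g i + 16 / 9 * ∑ c, ((δ c : ℤ) : ℝ) * q i c ≤ U δ := fun δ i => by
    refine le_ciSup (f := fun i => g i + 16 / 9 * ∑ c, ((δ c : ℤ) : ℝ) * q i c)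
      (bddAbove_range_of_abs_le (c := A + 16 / 9 * ∑ c : Fin C, B) fun i => ?_) i
    refine (abs_add_le _ _).trans (add_le_add (hg i) ?_)
    rw [abs_mul, abs_of_pos (by norm_num : (0 : ℝ) < 16 / 9)]
    gcongr
    refine (Finset.abs_sum_le_sum_abs _ _).trans (Finset.sum_le_sum fun c _ => ?_)
    rw [abs_mul, abs_sign, one_mul]
    exact hq i c
  have hneg : 𝔼 δ, U (-δ) = 𝔼 δ, U δ := Fintype.expect_equiv (Equiv.neg _) _ _ fun δ => rfl
  rw [div_le_iff₀ two_pos]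
  refine ciSup_add_ciSup_le_of_forall fun i j => ?_
  have k1 := sqrt_sum_sq_le_expect fun c => q i c - q j c
  -- According to the sign of the inner difference, `i` is tested in `U δ` and `j` in `U (-δ)`, or
  -- the other way round; this produces the absolute value that Khintchine needs.
  have k2 : ∀ δ : Fin C → ℤˣ, g i + g j + 16 / 9 * |∑ c, ((δ c : ℤ) : ℝ) * (q i c - q j c)| ≤
      U δ + U (-δ) := fun δ => by
    have e1 : ∀ i, ∑ c, (((-δ) c : ℤ) : ℝ) * q i c = -∑ c, ((δ c : ℤ) : ℝ) * q i c := fun i => by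
      simp
    have a1 := hU δ i
    have a2 := hU δ j
    have a3 := hU (-δ) i
    have a4 := hU (-δ) j
    rw [e1] at a3 a4
    simp_rw [mul_sub, Finset.sum_sub_distrib]
    rcases abs_cases (∑ c, ((δ c : ℤ) : ℝ) * q i c - ∑ c, ((δ c : ℤ) : ℝ) * q j c) with h | h <;>
      rw [h.1] <;> linarith
  have k3 := Finset.expect_le_expect (s := Finset.univ) fun δ _ => k2 δ
  rw [Finset.expect_add_distrib, Finset.expect_add_distrib, Fintype.expect_const,
    Fintype.expect_const, Finset.expect_add_distrib, hneg, ← Finset.mul_expect] at k3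
  change _ ≤ (𝔼 δ, U δ) * 2
  linarith [hpq i j, le_abs_self (p i - p j)]

/-- **Vector contraction** for Rademacher averages. -/
theorem expect_ciSup_le_of_contraction {C N : ℕ} {g : ι → ℝ} {h : ι → Fin N → ℝ}
    {φ : ι → Fin N → Fin C → ℝ} {A H B : ℝ} (hg : ∀ i, |g i| ≤ A) (hh : ∀ i n, |h i n| ≤ H)
    (hφ : ∀ i n c, |φ i n c| ≤ B)
    (hL : ∀ i j n, |h i n - h j n| ≤ Real.sqrt (∑ c, (φ i n c - φ j n c) ^ 2)) :
    𝔼 ε : Fin N → ℤˣ, ⨆ i, (g i + ∑ n, ((ε n : ℤ) : ℝ) * h i n) ≤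
      𝔼 δ : Fin N → Fin C → ℤˣ,
        ⨆ i, (g i + ∑ n, 16 / 9 * ∑ c, ((δ n c : ℤ) : ℝ) * φ i n c) := by
  induction N generalizing g A with
  | zero => simp
  | succ N ih =>
    rw [expect_fin_succ, expect_fin_succ]
    simp only [Fin.sum_univ_succ, Fin.cons_zero, Fin.cons_succ, ← add_assoc]
    -- For a frozen sign `u`, its term is absorbed into `g` and the induction hypothesis treats the
    -- other coordinates; afterwards `u` itself is replaced with the new signs frozen.
    calc _ ≤ 𝔼 u : ℤˣ, 𝔼 δ : Fin N → Fin C → ℤˣ, ⨆ i, (g i + ((u : ℤ) : ℝ) * h i 0 +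
            ∑ n, 16 / 9 * ∑ c, ((δ n c : ℤ) : ℝ) * φ i n.succ c) := by
          refine Finset.expect_le_expect fun u _ => ?_
          refine ih (A := A + H) (fun i => ?_) (fun i n => hh i n.succ) (fun i n => hφ i n.succ)
            fun i j n => hL i j n.succ
          refine (abs_add_le _ _).trans (add_le_add (hg i) ?_)
          rw [abs_mul, abs_sign, one_mul]
          exact hh i 0
      _ ≤ _ := by
          rw [Finset.expect_comm]
          conv_rhs => rw [Finset.expect_comm]
          refine Finset.expect_le_expect fun δ _ => ?_
          rw [expect_sign]
          have := half_ciSup_add_ciSup_le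
            (g := fun i => g i + ∑ n, 16 / 9 * ∑ c, ((δ n c : ℤ) : ℝ) * φ i n.succ c)
            (p := fun i => h i 0) (q := fun i => φ i 0)
            (A := A + ∑ n : Fin N, 16 / 9 * ∑ c : Fin C, B) (B := B)
            (fun i => ?_) (fun i => hφ i 0) fun i j => hL i j 0
          · refine le_trans (le_of_eq ?_) (this.trans (le_of_eq ?_))
            · congr 2
              · refine iSup_congr fun i => ?_
                push_cast
                ring
              · refine iSup_congr fun i => ?_
                push_cast
                ring
            · refine Finset.expect_congr rfl fun d _ => iSup_congr fun i => ?_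
              ring
          · refine (abs_add_le _ _).trans (add_le_add (hg i) ?_)
            refine (Finset.abs_sum_le_sum_abs _ _).trans (Finset.sum_le_sum fun n _ => ?_)
            rw [abs_mul, abs_of_pos (by norm_num : (0 : ℝ) < 16 / 9)]
            gcongr
            refine (Finset.abs_sum_le_sum_abs _ _).trans (Finset.sum_le_sum fun c _ => ?_)
            rw [abs_mul, abs_sign, one_mul]
            exact hφ _ _ c

end contraction

/-! ### From random signs to symmetric laws -/

/-- Comparison of Rademacher averages with averages over a symmetric integrable law. -/
theorem integral_abs_mul_expect_le {ι p : Type*} [Nonempty ι] [Fintype p] [DecidableEq p] (ν : Measure ℝ)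
    [IsProbabilityMeasure ν] (hs : ν.map (fun t => -t) = ν) (hi : Integrable (fun t => t) ν)
    {v : ι → p → ℝ} {B : ℝ} (hv : ∀ i k, |v i k| ≤ B) :
    (∫ t, |t| ∂ν) * 𝔼 δ : p → ℤˣ, ⨆ i, ∑ k, ((δ k : ℤ) : ℝ) * v i k ≤
      ∫ ξ : p → ℝ, (⨆ i, ∑ k, ξ k * v i k) ∂(Measure.pi fun _ => ν) := by
  set P : Measure (p → ℝ) := Measure.pi fun _ => ν with hP
  set F : (p → ℝ) → ℝ := fun ξ => ⨆ i, ∑ k, ξ k * v i k with hF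
  have hsum : ∀ (ξ : p → ℝ) i, |∑ k, ξ k * v i k| ≤ ∑ k, |ξ k| * B := fun ξ i => by
    refine (Finset.abs_sum_le_sum_abs _ _).trans (Finset.sum_le_sum fun k _ => ?_)
    rw [abs_mul]
    exact mul_le_mul_of_nonneg_left (hv i k) (abs_nonneg _)
  have hbdd : ∀ ξ : p → ℝ, BddAbove (Set.range fun i => ∑ k, ξ k * v i k) := fun ξ =>
    bddAbove_range_of_abs_le (hsum ξ)
  have hFb : ∀ ξ, |F ξ| ≤ ∑ k, |ξ k| * B := fun ξ => abs_ciSup_le (hsum ξ)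
  -- The index set may be uncountable, so measurability of the supremum comes from continuity.
  have hFc : Continuous F := by
    refine continuous_iff_continuousAt.2 fun ξ => ?_
    refine tendsto_iff_dist_tendsto_zero.2 ?_
    have hlim : Tendsto (fun η : p → ℝ => ∑ k, |η k - ξ k| * B) (𝓝 ξ) (𝓝 0) := by
      have : Continuous fun η : p → ℝ => ∑ k, |η k - ξ k| * B := by fun_prop
      simpa using this.tendsto ξ
    refine squeeze_zero (fun _ => dist_nonneg) (fun η => ?_) hlim
    rw [Real.dist_eq]
    refine abs_ciSup_sub_ciSup_le (hbdd η) (hbdd ξ) fun i => ?_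
    rw [← Finset.sum_sub_distrib]
    simpa only [sub_mul] using hsum (fun k => η k - ξ k) i
  have hcoord : ∀ k, Integrable (fun ξ : p → ℝ => |ξ k|) P := fun k =>
    (measurePreserving_eval (fun _ : p => ν) k).integrable_comp_of_integrable hi.abs
  have hcoordI : ∀ k, ∫ ξ : p → ℝ, |ξ k| ∂P = ∫ t, |t| ∂ν := fun k => by
    have mp := measurePreserving_eval (fun _ : p => ν) k
    have := integral_map (μ := P) mp.measurable.aemeasurable (f := fun t : ℝ => |t|)
      continuous_abs.measurable.aestronglyMeasurable
    rw [mp.map_eq] at this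
    exact this.symm
  have hInt : ∀ T : (p → ℝ) → p → ℝ, Continuous T → (∀ ξ k, |T ξ k| = |ξ k|) →
      Integrable (fun ξ => F (T ξ)) P := fun T hT hT2 => by
    refine Integrable.mono' (integrable_finsetSum Finset.univ fun k _ => (hcoord k).mul_const B)
      (hFc.comp hT).measurable.aestronglyMeasurable (ae_of_all _ fun ξ => ?_)
    refine (hFb _).trans (le_of_eq ?_)
    simp_rw [hT2]
  have flip : ∀ δ : p → ℤˣ, ∫ ξ, F ξ ∂P = ∫ ξ, F (fun k => ((δ k : ℤ) : ℝ) * ξ k) ∂P := fun δ => by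
    have mp : MeasurePreserving (fun (ξ : p → ℝ) k => ((δ k : ℤ) : ℝ) * ξ k) P P := by
      refine measurePreserving_pi (fun _ => ν) (fun _ => ν)
        (f := fun k t => ((δ k : ℤ) : ℝ) * t) fun k => ?_
      rcases Int.units_eq_one_or (δ k) with h | h
      · simp only [h, Units.val_one, Int.cast_one, one_mul]
        exact MeasurePreserving.id ν
      · refine ⟨by fun_prop, ?_⟩
        simpa [h] using hs
    have := integral_map (μ := P) mp.measurable.aemeasurable (f := F)
      hFc.measurable.aestronglyMeasurable
    rw [mp.map_eq] at this
    exact this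
  -- The signs of `ξ` are absorbed into the uniformly distributed `δ`.
  have habs : ∀ ξ : p → ℝ, 𝔼 δ : p → ℤˣ, F (fun k => ((δ k : ℤ) : ℝ) * ξ k) =
      𝔼 δ : p → ℤˣ, F (fun k => ((δ k : ℤ) : ℝ) * |ξ k|) := fun ξ => by
    let s : p → ℤˣ := fun k => if ξ k < 0 then -1 else 1
    refine Fintype.expect_equiv (Equiv.mulRight s) _ _ fun δ => ?_
    congr 1
    funext k
    by_cases hk : ξ k < 0
    · simp [s, hk, abs_of_neg hk]
    · simp [s, hk, abs_of_nonneg (not_lt.1 hk)]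
  have i1 : ∀ δ : p → ℤˣ, Integrable (fun ξ => F (fun k => ((δ k : ℤ) : ℝ) * ξ k)) P := fun δ =>
    hInt _ (by fun_prop) fun ξ k => by rw [abs_mul, abs_sign, one_mul]
  have i2 : ∀ δ : p → ℤˣ, Integrable (fun ξ => F (fun k => ((δ k : ℤ) : ℝ) * |ξ k|)) P := fun δ =>
    hInt _ (by fun_prop) fun ξ k => by rw [abs_mul, abs_sign, one_mul, abs_abs]
  have comm : ∀ Φ : (p → ℤˣ) → (p → ℝ) → ℝ, (∀ δ, Integrable (Φ δ) P) →
      𝔼 δ, ∫ ξ, Φ δ ξ ∂P = ∫ ξ, 𝔼 δ, Φ δ ξ ∂P := fun Φ hΦ => by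
    simp_rw [Fintype.expect_eq_sum_div_card]
    rw [integral_div, integral_finsetSum _ fun δ _ => hΦ δ]
  -- Jensen: `∫ |t|` is the mean of every `|ξ k|`, and the supremum of means is at most the mean of
  -- the supremum.
  calc (∫ t, |t| ∂ν) * 𝔼 δ : p → ℤˣ, ⨆ i, ∑ k, ((δ k : ℤ) : ℝ) * v i k
      ≤ 𝔼 δ : p → ℤˣ, ∫ ξ, F (fun k => ((δ k : ℤ) : ℝ) * |ξ k|) ∂P := by
        rw [Finset.mul_expect]
        refine Finset.expect_le_expect fun δ _ => ?_
        rw [Real.mul_iSup_of_nonneg (integral_nonneg fun t => abs_nonneg t)]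
        refine ciSup_le fun i => ?_
        have hterm : ∀ k, Integrable (fun ξ : p → ℝ => ((δ k : ℤ) : ℝ) * |ξ k| * v i k) P :=
          fun k => ((hcoord k).const_mul _).mul_const _
        have e : (∫ t, |t| ∂ν) * ∑ k, ((δ k : ℤ) : ℝ) * v i k =
            ∫ ξ : p → ℝ, ∑ k, ((δ k : ℤ) : ℝ) * |ξ k| * v i k ∂P := by
          rw [integral_finsetSum _ fun k _ => hterm k, Finset.mul_sum]
          refine Finset.sum_congr rfl fun k _ => ?_
          rw [integral_mul_const, integral_const_mul, hcoordI]
          ring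
        rw [e]
        exact integral_mono (integrable_finsetSum _ fun k _ => hterm k) (i2 δ) fun ξ =>
          le_ciSup (hbdd fun k => ((δ k : ℤ) : ℝ) * |ξ k|) i
    _ = 𝔼 δ : p → ℤˣ, ∫ ξ, F (fun k => ((δ k : ℤ) : ℝ) * ξ k) ∂P := by
        rw [comm _ i2, comm _ i1]
        exact integral_congr_ae (ae_of_all _ fun ξ => (habs ξ).symm)
    _ = ∫ ξ, F ξ ∂P := by
        rw [Finset.expect_congr rfl fun δ _ => (flip δ).symm]
        exact Fintype.expect_const _

/-! ### Lipschitz and range bounds for the surrogate loss -/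

namespace TKPR

variable {C : ℕ}

/-- Rearrangement inequality: sorting both vectors keeps the sums of squares and can only increase
the inner product. -/
theorem sum_sq_kthLargest_sub_le (s s' : Score C) :
    ∑ k, (kthLargest s k - kthLargest s' k) ^ 2 ≤ ‖s - s'‖ ^ 2 := by
  set σ := Tuple.sort fun i => s i
  set τ := Tuple.sort fun i => s' i
  have hσ : Monotone ((fun i => s i) ∘ σ) := Tuple.monotone_sort _
  have hτ : Monotone ((fun i => s' i) ∘ τ) := Tuple.monotone_sort _
  have hr := (hσ.monovary hτ).sum_mul_comp_perm_le_sum_mul (σ := σ.trans τ.symm)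
  simp only [Function.comp_apply, Equiv.trans_apply, Equiv.apply_symm_apply] at hr
  rw [Equiv.sum_comp σ fun i => s i * s' i] at hr
  have h1 : ∑ k, (kthLargest s k - kthLargest s' k) ^ 2 = ∑ k, (s (σ k) - s' (τ k)) ^ 2 :=
    Equiv.sum_comp Fin.revPerm fun k => (s (σ k) - s' (τ k)) ^ 2
  have h2 := Equiv.sum_comp σ fun i => s i ^ 2
  have h3 := Equiv.sum_comp τ fun i => s' i ^ 2
  rw [h1, EuclideanSpace.norm_sq_eq]
  simp only [PiLp.sub_apply, Real.norm_eq_abs, sq_abs, sub_sq, Finset.sum_add_distrib,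
    Finset.sum_sub_distrib, mul_assoc, ← Finset.mul_sum]
  linarith

theorem sum_abs_le_sqrt_mul {ι : Type*} [Fintype ι] (t : Finset ι) (a : ι → ℝ) {q r : ℝ}
    (hq : (t.card : ℝ) ≤ q) (hr : 0 ≤ r) (ha : ∑ i, a i ^ 2 ≤ r ^ 2) :
    ∑ i ∈ t, |a i| ≤ Real.sqrt q * r := by
  rw [← Real.sqrt_sq hr, ← Real.sqrt_mul ((Nat.cast_nonneg _).trans hq)]
  refine Real.le_sqrt_of_sq_le ((sq_sum_le_card_mul_sum_sq).trans ?_)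
  have : ∑ i ∈ t, |a i| ^ 2 ≤ ∑ i, a i ^ 2 := by
    simp only [sq_abs]
    exact Finset.sum_le_sum_of_subset_of_nonneg (Finset.subset_univ _) fun i _ _ => sq_nonneg _
  exact mul_le_mul hq (this.trans ha) (Finset.sum_nonneg fun i _ => sq_nonneg _)
    ((Nat.cast_nonneg _).trans hq)

theorem card_filter_le_succ (C K : ℕ) :
    ((Finset.univ.filter fun k : Fin C => (k : ℕ) ≤ K).card : ℝ) ≤ (K : ℝ) + 1 := by
  have : (Finset.univ.filter fun k : Fin C => (k : ℕ) ≤ K).card ≤ (Finset.range (K + 1)).card :=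
    Finset.card_le_card_of_injOn (fun k => (k : ℕ))
      (fun k hk => by
        have := (Finset.mem_filter.1 hk).2
        simpa using Nat.lt_succ_of_le this)
      fun a _ b _ h => Fin.ext h
  rw [Finset.card_range] at this
  exact_mod_cast this

theorem Weighting.rate_nonneg (K : ℕ) (w : Weighting) : 0 ≤ w.rate K := by
  cases w <;> simp only [Weighting.rate] <;> positivity

theorem Weighting.lossBound_nonneg (K : ℕ) {M : ℝ} (hM : 0 ≤ M) (w : Weighting) :
    0 ≤ w.lossBound K M := by
  cases w <;> simp only [Weighting.lossBound] <;> positivity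

theorem weight_pos {K : ℕ} {y : Label C} (hy : numRelevant y ≤ K) (hy0 : 1 ≤ numRelevant y)
    (w : Weighting) : 0 < w.weight K y := by
  have e : numRelevantCut K y = numRelevant y := min_eq_right hy
  have h1 : (1 : ℝ) ≤ numRelevant y := by exact_mod_cast hy0
  have h2 : (numRelevant y : ℝ) ≤ K := by exact_mod_cast hy
  cases w <;> simp only [Weighting.weight, e]
  · norm_num
  · linarith
  · exact mul_pos (by linarith) (by linarith)

/-- The Lipschitz constant of the weighted double sum is of the order of the rate. -/
theorem weight_lipschitz_le {K : ℕ} {y : Label C} (hy : numRelevant y ≤ K)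
    (hy0 : 1 ≤ numRelevant y) (w : Weighting) :
    1 / (w.weight K y * K) * (((K : ℝ) + 1) * Real.sqrt (numRelevant y) +
      numRelevant y * Real.sqrt ((K : ℝ) + 1)) ≤ 4 * w.rate K := by
  have hw := weight_pos hy hy0 w
  have e : numRelevantCut K y = numRelevant y := min_eq_right hy
  have h1 : (1 : ℝ) ≤ numRelevant y := by exact_mod_cast hy0
  have h2 : (numRelevant y : ℝ) ≤ K := by exact_mod_cast hy
  set n : ℝ := (numRelevant y : ℝ)
  have hK : (1 : ℝ) ≤ K := h1.trans h2
  have hK0 : (0 : ℝ) < K := by linarith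
  have hn : Real.sqrt n ≤ n := Real.sqrt_le_self_iff.2 (Or.inr h1)
  have hq : Real.sqrt (K + 1) ≤ K + 1 := Real.sqrt_le_self_iff.2 (Or.inr (by linarith))
  have hcrude : ((K : ℝ) + 1) * Real.sqrt n + n * Real.sqrt ((K : ℝ) + 1) ≤ 4 * (n * K) := by
    have a1 : ((K : ℝ) + 1) * Real.sqrt n ≤ (K + 1) * n := by gcongr
    have a2 : n * Real.sqrt ((K : ℝ) + 1) ≤ n * (K + 1) := by gcongr
    nlinarith
  rw [one_div, inv_mul_le_iff₀ (by positivity)]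
  cases w <;> simp only [Weighting.weight, Weighting.rate, e] at hw ⊢
  · have a1 : Real.sqrt n ≤ Real.sqrt K := Real.sqrt_le_sqrt h2
    have a2 : Real.sqrt (K + 1) ≤ 2 * Real.sqrt K := by
      rw [Real.sqrt_le_left (by positivity), mul_pow, Real.sq_sqrt hK0.le]
      linarith
    have b1 : ((K : ℝ) + 1) * Real.sqrt n ≤ (2 * K) * Real.sqrt K := by gcongr; linarith
    have b2 : n * Real.sqrt ((K : ℝ) + 1) ≤ K * (2 * Real.sqrt K) := by gcongr
    linarith
  -- For `α₂` the crude bound already gives the constant `4`, and `1 ≤ √K`.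
  · have a1 : 1 ≤ Real.sqrt K := Real.one_le_sqrt.2 hK
    have : n * K * 1 ≤ n * K * Real.sqrt K := by gcongr
    linarith
  · have a1 : ((K : ℝ) + 1) * Real.sqrt n ≤ (K + 1) * n := by gcongr
    have a2 : n * Real.sqrt ((K : ℝ) + 1) ≤ n * (K + 1) := by gcongr
    have a3 : n * ((2 * K + 1 - n) / 2) * K * (4 * (1 / K)) = 2 * (n * (2 * K + 1 - n)) := by
      field_simp
      ring
    -- Since `n ≤ K`, the factor `2 K + 1 - n` of `α₃` absorbs `K + 1`; this is what yields the rate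
    -- `1 / K`.
    have a4 : n * (K + 1) ≤ n * (2 * K + 1 - n) := by gcongr; linarith
    change _ ≤ n * ((2 * K + 1 - n) / 2) * K * (4 * (1 / K))
    rw [a3]
    linarith

/-- Each argument of `ℓ` moves by at most the change of one entry plus that of one order statistic.
Cauchy–Schwarz over the relevant labels and over the ranks separately gives the factors `√N(y)` and
`√(K + 1)`. -/
theorem abs_surrogateLoss_sub_le {K : ℕ} {ℓ : ℝ → ℝ} {μ : ℝ≥0} (hℓ : LipschitzWith μ ℓ)
    (w : Weighting) (s s' : Score C) {y : Label C} (hy : numRelevant y ≤ K) :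
    |surrogateLoss w K ℓ s y - surrogateLoss w K ℓ s' y| ≤ 4 * μ * w.rate K * ‖s - s'‖ := by
  have hrate := w.rate_nonneg K
  rcases Nat.eq_zero_or_pos (numRelevant y) with h0 | h0
  · have : relevant y = ∅ := Finset.card_eq_zero.1 h0
    simp only [surrogateLoss, this, Finset.sum_empty, mul_zero, sub_zero, abs_zero]
    positivity
  have hw := weight_pos hy h0 w
  set Q := Finset.univ.filter fun k : Fin C => (k : ℕ) ≤ K with hQ
  set r := ‖s - s'‖
  have hr : 0 ≤ r := norm_nonneg _
  set n : ℝ := (numRelevant y : ℝ) with hn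
  have d1 : ∑ i ∈ relevant y, |s i - s' i| ≤ Real.sqrt n * r :=
    sum_abs_le_sqrt_mul _ _ le_rfl hr (by
      simp [r, EuclideanSpace.norm_sq_eq])
  have d2 : ∑ k ∈ Q, |kthLargest s k - kthLargest s' k| ≤ Real.sqrt ((K : ℝ) + 1) * r :=
    sum_abs_le_sqrt_mul _ _ (card_filter_le_succ C K) hr (sum_sq_kthLargest_sub_le s s')
  have main : |∑ i ∈ relevant y, ∑ k ∈ Q, ℓ (s i - kthLargest s k) -
      ∑ i ∈ relevant y, ∑ k ∈ Q, ℓ (s' i - kthLargest s' k)| ≤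
      μ * (((K : ℝ) + 1) * Real.sqrt n + n * Real.sqrt ((K : ℝ) + 1)) * r := by
    rw [← Finset.sum_sub_distrib]
    simp_rw [← Finset.sum_sub_distrib]
    calc _ ≤ ∑ i ∈ relevant y, ∑ k ∈ Q,
          μ * (|s i - s' i| + |kthLargest s k - kthLargest s' k|) := by
          refine (Finset.abs_sum_le_sum_abs _ _).trans (Finset.sum_le_sum fun i _ => ?_)
          refine (Finset.abs_sum_le_sum_abs _ _).trans (Finset.sum_le_sum fun k _ => ?_)
          have := hℓ.dist_le_mul (s i - kthLargest s k) (s' i - kthLargest s' k)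
          rw [Real.dist_eq, Real.dist_eq] at this
          refine this.trans (mul_le_mul_of_nonneg_left ?_ μ.2)
          rw [sub_sub_sub_comm]
          exact abs_sub _ _
      _ = μ * (Q.card * ∑ i ∈ relevant y, |s i - s' i| +
            n * ∑ k ∈ Q, |kthLargest s k - kthLargest s' k|) := by
          simp_rw [← Finset.mul_sum, Finset.sum_add_distrib, Finset.sum_const, nsmul_eq_mul,
            ← Finset.mul_sum]
          rfl
      _ ≤ μ * (((K : ℝ) + 1) * (Real.sqrt n * r) + n * (Real.sqrt ((K : ℝ) + 1) * r)) := by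
          have := card_filter_le_succ C K
          gcongr
      _ = _ := by ring
  have hpos : 0 ≤ 1 / (w.weight K y * K) := by positivity
  rw [surrogateLoss, surrogateLoss, ← mul_sub, abs_mul, abs_of_nonneg hpos]
  calc _ ≤ 1 / (w.weight K y * K) *
        (μ * (((K : ℝ) + 1) * Real.sqrt n + n * Real.sqrt ((K : ℝ) + 1)) * r) := by gcongr
    _ = μ * r * (1 / (w.weight K y * K) *
        (((K : ℝ) + 1) * Real.sqrt n + n * Real.sqrt ((K : ℝ) + 1))) := by ring
    _ ≤ μ * r * (4 * w.rate K) := by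
        exact mul_le_mul_of_nonneg_left (weight_lipschitz_le hy h0 w) (by positivity)
    _ = _ := by ring

theorem surrogateLoss_mem {K : ℕ} (hK : 1 ≤ K) {ℓ : ℝ → ℝ} {M : ℝ} (hℓ : ∀ t, 0 ≤ ℓ t ∧ ℓ t ≤ M)
    (w : Weighting) (s : Score C) {y : Label C} (hy : numRelevant y ≤ K) :
    0 ≤ surrogateLoss w K ℓ s y ∧ surrogateLoss w K ℓ s y ≤ w.lossBound K M := by
  have hM : 0 ≤ M := (hℓ 0).1.trans (hℓ 0).2
  rcases Nat.eq_zero_or_pos (numRelevant y) with h0 | h0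
  · have : relevant y = ∅ := Finset.card_eq_zero.1 h0
    simp only [surrogateLoss, this, Finset.sum_empty, mul_zero]
    exact ⟨le_rfl, w.lossBound_nonneg K hM⟩
  have hw := weight_pos hy h0 w
  have hK1 : (1 : ℝ) ≤ K := by exact_mod_cast hK
  have hK0 : (0 : ℝ) < K := by linarith
  have e : numRelevantCut K y = numRelevant y := min_eq_right hy
  have h1 : (1 : ℝ) ≤ numRelevant y := by exact_mod_cast h0
  have h2 : (numRelevant y : ℝ) ≤ K := by exact_mod_cast hy
  refine ⟨mul_nonneg (by positivity)
    (Finset.sum_nonneg fun i _ => Finset.sum_nonneg fun k _ => (hℓ _).1), ?_⟩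
  have hsum : ∑ i ∈ relevant y, ∑ k ∈ Finset.univ.filter (fun k : Fin C => (k : ℕ) ≤ K),
      ℓ (s i - kthLargest s k) ≤ numRelevant y * (((K : ℝ) + 1) * M) := by
    calc _ ≤ ∑ i ∈ relevant y, ∑ k ∈ Finset.univ.filter (fun k : Fin C => (k : ℕ) ≤ K), M :=
          Finset.sum_le_sum fun i _ => Finset.sum_le_sum fun k _ => (hℓ _).2
      _ = numRelevant y *
          ((Finset.univ.filter (fun k : Fin C => (k : ℕ) ≤ K)).card * M) := by
          simp only [Finset.sum_const, nsmul_eq_mul]; rfl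
      _ ≤ _ := by
          have := card_filter_le_succ C K
          gcongr
  rw [surrogateLoss, one_div, inv_mul_le_iff₀ (by positivity)]
  refine hsum.trans ?_
  have hq : 0 ≤ ((K : ℝ) + 1) * M := by positivity
  set n : ℝ := (numRelevant y : ℝ)
  cases w <;> simp only [Weighting.weight, Weighting.lossBound, e]
  · rw [one_mul]; gcongr
  · have : n * 1 * ((K + 1) * M) ≤ n * K * ((K + 1) * M) := by gcongr
    linarith
  · have a : n * ((2 * (K : ℝ) + 1 - n) / 2) * K * ((K + 1) / K * M) =
        n * ((2 * K + 1 - n) / 2) * ((K + 1) * M) := by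
      field_simp
    change _ ≤ n * ((2 * (K : ℝ) + 1 - n) / 2) * K * ((K + 1) / K * M)
    rw [a]
    have : n * 1 * ((K + 1) * M) ≤ n * ((2 * K + 1 - n) / 2) * ((K + 1) * M) := by
      gcongr
      linarith
    linarith

/-- The surrogate loss, cut off at label vectors with more than `K` relevant labels. -/
noncomputable def cutLoss (w : Weighting) (K : ℕ) (ℓ : ℝ → ℝ) (s : Score C) (y : Label C) : ℝ :=
  if numRelevant y ≤ K then surrogateLoss w K ℓ s y else 0

theorem abs_cutLoss_sub_le {K : ℕ} {ℓ : ℝ → ℝ} {μ : ℝ≥0} (hℓ : LipschitzWith μ ℓ)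
    (w : Weighting) (s s' : Score C) (y : Label C) :
    |cutLoss w K ℓ s y - cutLoss w K ℓ s' y| ≤ 4 * μ * w.rate K * ‖s - s'‖ := by
  unfold cutLoss
  split_ifs with hy
  · exact abs_surrogateLoss_sub_le hℓ w s s' hy
  · have := w.rate_nonneg K
    simp only [sub_zero, abs_zero]
    positivity

theorem continuous_cutLoss {K : ℕ} {ℓ : ℝ → ℝ} {μ : ℝ≥0} (hℓ : LipschitzWith μ ℓ)
    (w : Weighting) (y : Label C) : Continuous fun s => cutLoss w K ℓ s y := by
  have := w.rate_nonneg K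
  refine (LipschitzWith.of_dist_le_mul (K := ⟨4 * μ * w.rate K, by positivity⟩)
    fun s s' => ?_).continuous
  rw [Real.dist_eq, dist_eq_norm]
  exact abs_cutLoss_sub_le hℓ w s s' y

theorem cutLoss_mem {K : ℕ} (hK : 1 ≤ K) {ℓ : ℝ → ℝ} {M : ℝ} (hℓ : ∀ t, 0 ≤ ℓ t ∧ ℓ t ≤ M)
    (w : Weighting) (s : Score C) (y : Label C) :
    0 ≤ cutLoss w K ℓ s y ∧ cutLoss w K ℓ s y ≤ w.lossBound K M := by
  unfold cutLoss
  split_ifs with hy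
  · exact surrogateLoss_mem hK hℓ w s hy
  · exact ⟨le_rfl, w.lossBound_nonneg K ((hℓ 0).1.trans (hℓ 0).2)⟩

theorem measurable_cutLoss {X : Type*} [MeasurableSpace X] {K : ℕ} {ℓ : ℝ → ℝ} {μ : ℝ≥0}
    (hℓ : LipschitzWith μ ℓ) (w : Weighting) {f : X → Score C} (hf : Measurable f) :
    Measurable fun z : X × Label C => cutLoss w K ℓ (f z.1) z.2 :=
  measurable_from_prod_countable_left fun y => (continuous_cutLoss hℓ w y).measurable.comp hf

/-- A real Lipschitz extension truncated to `[0, M]`: truncation keeps the Lipschitz constant and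
changes nothing on `T`. -/
theorem exists_lipschitz_extension {T : Set ℝ} {ℓ : ℝ → ℝ} {μ : ℝ≥0} {M : ℝ} (hM : 0 ≤ M)
    (hℓ : LipschitzOnWith μ ℓ T) (hb : ∀ t ∈ T, 0 ≤ ℓ t ∧ ℓ t ≤ M) :
    ∃ ℓ' : ℝ → ℝ, LipschitzWith μ ℓ' ∧ (∀ t, 0 ≤ ℓ' t ∧ ℓ' t ≤ M) ∧ Set.EqOn ℓ ℓ' T := by
  obtain ⟨g, hg, he⟩ := hℓ.extend_real
  refine ⟨fun t => max 0 (min M (g t)), (hg.const_min M).const_max 0, fun t =>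
    ⟨le_max_left _ _, max_le hM (min_le_left _ _)⟩, fun t ht => ?_⟩
  have := hb t ht
  simp only [← he ht]
  rw [min_eq_right this.2, max_eq_right this.1]

/-- Each `s_[k]` is itself an entry of `s`, so `ℓ` is only evaluated at score differences. -/
theorem surrogateLoss_congr {X : Type*} {F : Set (X → Score C)} {ℓ ℓ' : ℝ → ℝ}
    (h : Set.EqOn ℓ ℓ' (scoreDiffs F)) (w : Weighting) (K : ℕ) {f : X → Score C} (hf : f ∈ F)
    (x : X) (y : Label C) : surrogateLoss w K ℓ (f x) y = surrogateLoss w K ℓ' (f x) y := by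
  unfold surrogateLoss
  congr 1
  exact Finset.sum_congr rfl fun i _ => Finset.sum_congr rfl fun k _ =>
    h ⟨f, hf, x, i, _, rfl⟩

theorem norm_sub_eq_sqrt {C : ℕ} (s s' : Score C) : ‖s - s'‖ = Real.sqrt (∑ c, (s c - s' c) ^ 2) := by
  simp [EuclideanSpace.norm_eq]

/-! ### Transfer to classes of score functions -/

/-- The Rademacher average of a Lipschitz loss class is bounded by the complexity of the class of
score functions. -/
theorem radAvg_le_complexity {X : Type*} {C N : ℕ} (ν : Measure ℝ) [IsProbabilityMeasure ν]
    (hs : ν.map (fun t => -t) = ν) (hi : Integrable (fun t => t) ν) (hν : 0 < ∫ t, |t| ∂ν)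
    {F : Set (X → Score C)} (hF : F.Nonempty) (x : Fin N → X)
    (hbd : ∀ n, Bornology.IsBounded {v | ∃ f ∈ F, v = f (x n)})
    {h : F → Fin N → ℝ} {L H : ℝ} (hL0 : 0 ≤ L) (hH : ∀ f n, |h f n| ≤ H)
    (hL : ∀ f g : F, ∀ n, |h f n - h g n| ≤ L * ‖(f : X → Score C) (x n) - (g : X → Score C) (x n)‖) :
    1 / (N : ℝ) * radAvg h ≤ 16 / 9 * L / (∫ t, |t| ∂ν) * complexity ν F x := by
  have : Nonempty F := hF.to_subtype
  choose b hb using fun n => (hbd n).exists_norm_le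
  set B := ∑ n, |b n| with hB
  have hfB : ∀ (f : F) n c, |(f : X → Score C) (x n) c| ≤ B := fun f n c =>
    (PiLp.norm_apply_le ((f : X → Score C) (x n)) c).trans <|
      (hb n _ ⟨f, f.2, rfl⟩).trans <| (le_abs_self _).trans <|
        Finset.single_le_sum (f := fun n => |b n|) (fun n _ => abs_nonneg _) (Finset.mem_univ n)
  -- Scaling the scores by `L` makes the losses 1-Lipschitz in them, as contraction requires.
  have c1 := expect_ciSup_le_of_contraction (g := fun _ : F => 0) (h := h)
    (φ := fun f n c => L * (f : X → Score C) (x n) c) (A := 0) (B := L * B) (fun _ => by simp) hH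
    (fun f n c => by
      rw [abs_mul, abs_of_nonneg hL0]
      exact mul_le_mul_of_nonneg_left (hfB f n c) hL0)
    (fun f g n => by
      refine (hL f g n).trans (le_of_eq ?_)
      simp_rw [← mul_sub, mul_pow, ← Finset.mul_sum]
      rw [Real.sqrt_mul (sq_nonneg L), Real.sqrt_sq hL0, norm_sub_eq_sqrt])
  have c2 := integral_abs_mul_expect_le (p := Fin N × Fin C) ν hs hi
    (v := fun (f : F) k => (f : X → Score C) (x k.1) k.2) (B := B) fun f k => hfB f k.1 k.2
  simp_rw [Fintype.sum_prod_type] at c2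
  have e1 : 𝔼 δ : Fin N → Fin C → ℤˣ, ⨆ f : F, ((0 : ℝ) + ∑ n, 16 / 9 * ∑ c,
      ((δ n c : ℤ) : ℝ) * (L * (f : X → Score C) (x n) c)) =
      16 / 9 * L * 𝔼 δ : Fin N × Fin C → ℤˣ, ⨆ f : F, ∑ n, ∑ c,
        ((δ (n, c) : ℤ) : ℝ) * (f : X → Score C) (x n) c := by
    rw [Finset.mul_expect]
    refine Fintype.expect_equiv (Equiv.curry (Fin N) (Fin C) ℤˣ).symm _ _ fun δ => ?_
    rw [Real.mul_iSup_of_nonneg (by positivity)]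
    refine iSup_congr fun f => ?_
    simp only [zero_add, Finset.mul_sum, Equiv.curry_symm_apply, Function.uncurry_apply_pair]
    exact Finset.sum_congr rfl fun n _ => Finset.sum_congr rfl fun c _ => by ring
  have e2 : complexity ν F x = 1 / (N : ℝ) * ∫ ξ : Fin N × Fin C → ℝ,
      (⨆ f : F, ∑ n, ∑ c, ξ (n, c) * (f : X → Score C) (x n) c)
        ∂(Measure.pi fun _ => ν) := by
    rw [complexity, ← integral_const_mul]
    congr 1
    funext ξ
    rw [Real.mul_iSup_of_nonneg (by positivity)]
  rw [e1] at c1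
  simp only [zero_add] at c1
  rw [e2]
  set κ := ∫ t, |t| ∂ν
  set I := ∫ ξ : Fin N × Fin C → ℝ,
      (⨆ f : F, ∑ n, ∑ c, ξ (n, c) * (f : X → Score C) (x n) c) ∂(Measure.pi fun _ => ν)
  set Q := 𝔼 δ : Fin N × Fin C → ℤˣ, ⨆ f : F, ∑ n, ∑ c,
        ((δ (n, c) : ℤ) : ℝ) * (f : X → Score C) (x n) c
  have c3 : Q ≤ I / κ := by rw [le_div_iff₀ hν, mul_comm]; exact c2
  change radAvg h ≤ 16 / 9 * L * Q at c1
  calc 1 / (N : ℝ) * radAvg h ≤ 1 / (N : ℝ) * (16 / 9 * L * (I / κ)) := by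
        gcongr
        exact c1.trans (by gcongr)
    _ = _ := by ring

/-- Passes from the countable subclass to the full class. The bound on `v` matters: the real
supremum of a set unbounded above is `0` by convention. -/
theorem radAvg_mono {ι ι' : Type*} [Nonempty ι] {N : ℕ} {v : ι' → Fin N → ℝ} {H : ℝ}
    (hv : ∀ i n, |v i n| ≤ H) (e : ι → ι') : radAvg (fun i => v (e i)) ≤ radAvg v := by
  refine Finset.expect_le_expect fun ε _ => ciSup_le fun i => ?_
  refine le_ciSup (f := fun i => ∑ n, ((ε n : ℤ) : ℝ) * v i n)
    (bddAbove_range_of_abs_le (c := ∑ n : Fin N, H) fun i => ?_) (e i)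
  refine (Finset.abs_sum_le_sum_abs _ _).trans (Finset.sum_le_sum fun n _ => ?_)
  rw [abs_mul, abs_sign, one_mul]
  exact hv i n

variable {X : Type*} [MeasurableSpace X] {C K : ℕ}

theorem measurableSet_numRelevant_le (K : ℕ) :
    MeasurableSet {z : X × Label C | numRelevant z.2 ≤ K} :=
  measurable_snd (Set.toFinite {y : Label C | numRelevant y ≤ K}).measurableSet

theorem integrable_cutLoss (hK : 1 ≤ K) {D : Measure (X × Label C)} [IsProbabilityMeasure D]
    {ℓ : ℝ → ℝ} {μ : ℝ≥0} {M : ℝ} (hℓ : LipschitzWith μ ℓ) (hb : ∀ t, 0 ≤ ℓ t ∧ ℓ t ≤ M)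
    (w : Weighting) {f : X → Score C} (hf : Measurable f) :
    Integrable (fun z => cutLoss w K ℓ (f z.1) z.2) D :=
  Integrable.of_bound (measurable_cutLoss hℓ w hf).aestronglyMeasurable (w.lossBound K M)
    (ae_of_all _ fun z => by
      have := cutLoss_mem hK hb w (f z.1) z.2
      rw [Real.norm_eq_abs, abs_of_nonneg this.1]
      exact this.2)

theorem surrogateLoss_ae_eq_cutLoss {D : Measure (X × Label C)}
    (hD : ∀ᵐ z ∂D, numRelevant z.2 ≤ K) {F : Set (X → Score C)} {ℓ ℓ' : ℝ → ℝ}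
    (h : Set.EqOn ℓ ℓ' (scoreDiffs F)) (w : Weighting) {f : X → Score C} (hf : f ∈ F) :
    (fun z => surrogateLoss w K ℓ (f z.1) z.2) =ᵐ[D] fun z => cutLoss w K ℓ' (f z.1) z.2 := by
  filter_upwards [hD] with z hz
  rw [cutLoss, if_pos hz, surrogateLoss_congr h w K hf]

/-- The generalization bound for the cut-off losses of a pointwise separable class. -/
theorem exists_measurableSet_cutLoss {N : ℕ} (hN : 1 ≤ N) (hK : 1 ≤ K)
    (D : Measure (X × Label C)) [IsProbabilityMeasure D] {F : Set (X → Score C)}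
    (hF : F.Nonempty) (hsep : PointwiseSeparable F) {ℓ : ℝ → ℝ} {μ : ℝ≥0} {M : ℝ}
    (hℓ : LipschitzWith μ ℓ) (hb : ∀ t, 0 ≤ ℓ t ∧ ℓ t ≤ M) (w : Weighting) {δ : ℝ}
    (hδ : 0 < δ) (hδ1 : δ < 1) :
    ∃ E : Set (Fin N → X × Label C), MeasurableSet E ∧
      ENNReal.ofReal (1 - δ) ≤ (Measure.pi fun _ : Fin N => D) E ∧
      ∀ S ∈ E, ∀ f ∈ F, ∫ z, cutLoss w K ℓ (f z.1) z.2 ∂D ≤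
        1 / (N : ℝ) * ∑ n, cutLoss w K ℓ (f (S n).1) (S n).2 +
        3 * w.lossBound K M * Real.sqrt (Real.log (2 / δ) / (2 * N)) +
        2 * (1 / (N : ℝ) *
          radAvg fun (f : F) n => cutLoss w K ℓ ((f : X → Score C) (S n).1) (S n).2) := by
  obtain ⟨hm, G, hGF, hGc, hlim⟩ := hsep
  have hM : 0 ≤ M := (hb 0).1.trans (hb 0).2
  have : Countable G := hGc.to_subtype
  have hGne : G.Nonempty := by
    obtain ⟨f, hf⟩ := hF
    obtain ⟨u, hu, -⟩ := hlim f hf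
    exact ⟨u 0, hu 0⟩
  have : Nonempty G := hGne.to_subtype
  have habs : ∀ s y, |cutLoss w K ℓ (s : Score C) y| ≤ w.lossBound K M := fun s y => by
    have := cutLoss_mem hK hb w s y
    rw [abs_of_nonneg this.1]
    exact this.2
  obtain ⟨E, mE, hE, hbound⟩ := exists_measurableSet_generalization D hN
    (h := fun (g : G) z => cutLoss w K ℓ ((g : X → Score C) z.1) z.2)
    (w.lossBound_nonneg K hM) (fun g => measurable_cutLoss hℓ w (hm g (hGF g.2)))
    (fun g z => cutLoss_mem hK hb w _ _) hδ hδ1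
  refine ⟨E, mE, hE, fun S hS f hf => ?_⟩
  obtain ⟨u, hu, hconv⟩ := hlim f hf
  -- The bound holds along the approximating sequence. Risks converge by dominated convergence,
  -- empirical risks by continuity, and the Rademacher term of all of `F` does not depend on `m`.
  have t1 : Tendsto (fun m => ∫ z, cutLoss w K ℓ (u m z.1) z.2 ∂D) atTop
      (𝓝 (∫ z, cutLoss w K ℓ (f z.1) z.2 ∂D)) :=
    tendsto_integral_of_dominated_convergence (fun _ => w.lossBound K M)
      (fun m => (measurable_cutLoss hℓ w (hm _ (hGF (hu m)))).aestronglyMeasurable)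
      (integrable_const _) (fun m => ae_of_all _ fun z => habs _ _)
      (ae_of_all _ fun z => ((continuous_cutLoss hℓ w z.2).tendsto _).comp (hconv z.1))
  have t2 : Tendsto (fun m => 1 / (N : ℝ) * ∑ n, cutLoss w K ℓ (u m (S n).1) (S n).2) atTop
      (𝓝 (1 / (N : ℝ) * ∑ n, cutLoss w K ℓ (f (S n).1) (S n).2)) :=
    (tendsto_finsetSum _ fun n _ =>
      ((continuous_cutLoss hℓ w (S n).2).tendsto _).comp (hconv (S n).1)).const_mul _
  refine le_of_tendsto_of_tendsto' t1 ((t2.add_const _).add_const _) fun m => ?_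
  refine (hbound S hS ⟨u m, hu m⟩).trans ?_
  gcongr
  exact radAvg_mono (v := fun (f : F) n => cutLoss w K ℓ ((f : X → Score C) (S n).1) (S n).2)
    (fun f n => habs _ _) fun g : G => (⟨g, hGF g.2⟩ : F)

end TKPR

/-! ### The generalization bound -/

theorem mainTheorem10 (ν : Measure ℝ) [IsProbabilityMeasure ν]
    (hν_symm : ν.map (fun t => -t) = ν) (hν_int : Integrable (fun t => t) ν)
    (hν_pos : 0 < ∫ t, |t| ∂ν) :
    ∃ A : ℝ, 0 < A ∧
      ∀ (X : Type*) [MeasurableSpace X] (C K N : ℕ) (D : Measure (X × TKPR.Label C))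
        [IsProbabilityMeasure D] (F : Set (X → TKPR.Score C)) (ℓ : ℝ → ℝ) (μ : ℝ≥0) (M : ℝ)
        (w : TKPR.Weighting),
        1 ≤ N → 1 ≤ K → K + 1 ≤ C →
        TKPR.PointwiseSeparable F →
        LipschitzOnWith μ ℓ (TKPR.scoreDiffs F) →
        (∀ t ∈ TKPR.scoreDiffs F, 0 ≤ ℓ t ∧ ℓ t ≤ M) →
        (∀ᵐ z ∂D, TKPR.numRelevant z.2 ≤ K) →
        (∀ f ∈ F, Integrable (fun z => TKPR.surrogateLoss w K ℓ (f z.1) z.2) D) ∧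
        ∀ δ : ℝ, 0 < δ → δ < 1 →
          ∃ E : Set (Fin N → X × TKPR.Label C), MeasurableSet E ∧
            ENNReal.ofReal (1 - δ) ≤ (Measure.pi fun _ : Fin N => D) E ∧
            ∀ S ∈ E, (∀ n, Bornology.IsBounded {v | ∃ f ∈ F, v = f (S n).1}) →
              ∀ f ∈ F,
                TKPR.risk w K ℓ D f ≤
                  TKPR.Phi w K ℓ M δ S f +
                    A * μ * w.rate K * TKPR.complexity ν F (fun n => (S n).1) := by
  -- The factors are `2` from symmetrization, `16 / 9` from Khintchine, `4` from the Lipschitz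
  -- constant of the loss, and `1 / 𝔼|ξ|` from the comparison of laws.
  refine ⟨2 * (16 / 9 * 4 / ∫ t, |t| ∂ν), by positivity, ?_⟩
  intro X _ C K N D _ F ℓ μ M w hN hK hKC hsep hℓ hb hD
  -- For empty `F` there are no score differences, so nothing forces `0 ≤ M`.
  rcases F.eq_empty_or_nonempty with rfl | hF
  · refine ⟨fun f hf => hf.elim, fun δ hδ hδ1 => ⟨Set.univ, MeasurableSet.univ, ?_,
      fun S _ _ f hf => hf.elim⟩⟩
    rw [measure_univ, ENNReal.ofReal_le_one]
    linarith
  have hM : 0 ≤ M := by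
    obtain ⟨f, hf⟩ := hF
    obtain ⟨x⟩ : Nonempty X := (nonempty_of_isProbabilityMeasure D).map Prod.fst
    have i : Fin C := ⟨0, by omega⟩
    have := hb _ ⟨f, hf, x, i, i, rfl⟩
    exact this.1.trans this.2
  obtain ⟨ℓ', hℓ', hb', heq⟩ := TKPR.exists_lipschitz_extension hM hℓ hb
  have hae := fun {f : X → TKPR.Score C} (hf : f ∈ F) =>
    TKPR.surrogateLoss_ae_eq_cutLoss hD heq w hf
  refine ⟨fun f hf => (TKPR.integrable_cutLoss hK hℓ' hb' w (hsep.1 f hf)).congr (hae hf).symm,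
    fun δ hδ hδ1 => ?_⟩
  obtain ⟨E, mE, hE, hbound⟩ :=
    TKPR.exists_measurableSet_cutLoss hN hK D hF hsep hℓ' hb' w hδ hδ1
  -- On this almost sure event the cut-off does not alter the empirical risk.
  set R : Set (Fin N → X × TKPR.Label C) := {S | ∀ n, TKPR.numRelevant (S n).2 ≤ K} with hR
  have mR : MeasurableSet R := by
    have : R = ⋂ n, (fun S : Fin N → X × TKPR.Label C => S n) ⁻¹'
        {z | TKPR.numRelevant z.2 ≤ K} := by
      ext S
      simp [hR]
    rw [this]
    exact MeasurableSet.iInter fun n =>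
      measurable_pi_apply n (TKPR.measurableSet_numRelevant_le K)
  have hRae : ∀ᵐ S ∂(Measure.pi fun _ : Fin N => D), S ∈ R :=
    ae_all_iff.2 fun n => (Measure.tendsto_eval_ae_ae (μ := fun _ : Fin N => D) (i := n)) hD
  refine ⟨E ∩ R, mE.inter mR, hE.trans_eq ?_, fun S hS hbd f hf => ?_⟩
  · refine measure_congr ?_
    filter_upwards [hRae] with S hS
    exact propext ⟨fun h => ⟨h, hS⟩, fun h => h.1⟩
  · have h1 := hbound S hS.1 f hf
    have hrisk : TKPR.risk w K ℓ D f = ∫ z, TKPR.cutLoss w K ℓ' (f z.1) z.2 ∂D :=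
      integral_congr_ae (hae hf)
    have hemp : TKPR.empRisk w K ℓ S f =
        1 / (N : ℝ) * ∑ n, TKPR.cutLoss w K ℓ' (f (S n).1) (S n).2 := by
      rw [TKPR.empRisk]
      congr 1
      refine Finset.sum_congr rfl fun n _ => ?_
      rw [TKPR.cutLoss, if_pos (hS.2 n), TKPR.surrogateLoss_congr heq w K hf]
    have hrate := w.rate_nonneg K
    have h2 := TKPR.radAvg_le_complexity ν hν_symm hν_int hν_pos hF (fun n => (S n).1) hbd
      (h := fun (f : F) n => TKPR.cutLoss w K ℓ' ((f : X → TKPR.Score C) (S n).1) (S n).2)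
      (L := 4 * μ * w.rate K) (H := w.lossBound K M) (by positivity)
      (fun f n => by
        have := TKPR.cutLoss_mem hK hb' w ((f : X → TKPR.Score C) (S n).1) (S n).2
        rw [abs_of_nonneg this.1]
        exact this.2)
      (fun f g n => TKPR.abs_cutLoss_sub_le hℓ' w _ _ _)
    rw [hrisk, TKPR.Phi, hemp]
    refine h1.trans ?_
    have e : 2 * (16 / 9 * 4 / ∫ t, |t| ∂ν) * μ * w.rate K *
        TKPR.complexity ν F (fun n => (S n).1) =
        2 * (16 / 9 * (4 * μ * w.rate K) / (∫ t, |t| ∂ν) *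
          TKPR.complexity ν F (fun n => (S n).1)) := by ring
    rw [e]
    gcongr
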